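/- Let $X$ be a set with at least two elements; maps are composed from left to right. Let $Sing(X)$ be the set of non-bijective maps $X\to X$, and for $a\colon X\to X$ let $\pi_a$ be the partition of $X$ into the fibres of $a$. The powerset category $\mathscr P(X)$ has as objects the non-empty proper subsets of $X$ and as morphisms all functions between them; its inclusions are the inclusion maps. The category of partitions $\Pi(X)$ has one object $\bar\pi$, the set of all functions $\pi\to X$, for each partition $\pi$ of $X$ other than the partition into singletons; its morphisms $\bar\pi_1\to\bar\pi_2$ are the maps $\eta^*\colon\alpha\mapsto\eta\alpha$ with $\eta\colon\pi_2\to\pi_1$ a function; $\bar\pi_1\subseteq\bar\pi_2$ means that $\pi_2$ refines $\pi_1$, and the inclusion is $\nu^*$, where $\nu$ sends a block of $\pi_2$ to the block of $\pi_1$ containing it. For a normal category $\mathcal C$, a normal cone $\gamma$ with vertex $c_\gamma$ is a family of morphisms $\gamma(c)\colon c\to c_\gamma$ compatible with inclusions, at least one of which is an isomorphism; $\gamma*f$ is the cone $c\mapsto\gamma(c)f$; $f^\circ$ is the epimorphic component of $f$; $H(\gamma;-)$ is the functor $\mathcal C\to\mathbf{Set}$ with $H(\gamma;c)=\{\gamma*f^\circ: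 f\colon c_\gamma\to c\}$ and $H(\gamma;g)\colon\gamma*f^\circ\mapsto\gamma*(fg)^\circ$; and $M\gamma=MH(\gamma;-)$ is the set of objects $c$ with $\gamma(c)$ invertible. The normal dual $N^*\mathcal C$ is the category of the functors $H(\varepsilon;-)$, $\varepsilon$ an idempotent normal cone (for the product $\gamma\cdot\sigma=\gamma*(\sigma(c_\gamma))^\circ$), and all natural transformations between them; its subobjects are subfunctors. A cross-connection from $\mathcal D$ to $\mathcal C$ is a local isomorphism $\Gamma\colon\mathcal D\to N^*\mathcal C$ (an inclusion-preserving fully faithful functor that maps the full subcategory of the subobjects of each object $d$ isomorphically onto that of $\Gamma(d)$) such that every object $c$ of $\mathcal C$ lies in $M\Gamma(d)$ for some $d$. Its bifunctor is $\Gamma(c,d)=\Gamma(d)(c)$ on $\mathcal C\times\mathcal D$; for a cross-connection $\Delta\colon\mathcal C\to N^*\mathcal D$ one puts $\Delta(c,d)=\Delta(c)(d)$. Such a $\Delta$ is dual to $\Gamma$, with associated duality $\chi$, if $c\in M\Gamma(d)\Leftrightarrow d\in M\Delta(c)$ for all $c,d$, and $\chi\colon\Gamma(-,-)\to\Delta(-,-)$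 is a natural isomorphism that sends the idempotent cone with vertex $c$ generating $\Gamma(d)$ to the idempotent cone with vertex $d$ generating $\Delta(c)$ whenever $c\in M\Gamma(d)$. Each non-injective $a\in Sing(X)$ with $\mathrm{Im}\,a\ne X$ defines a normal cone $\rho^a$ in $\mathscr P(X)$, with vertex $\mathrm{Im}\,a$ and components the restrictions of $a$, and a cone $\sigma^a$ in $\Pi(X)$, with vertex $\bar\pi_a$ and with component at $\bar\alpha$ equal to $\eta^*$, where $\eta$ sends the block of $x$ in $\pi_a$ to the block of $(x)a$ in $\alpha$. The categories $\Pi(X)$ and $\mathscr P(X)$ are mapped to $N^*\mathscr P(X)$ and $N^*\Pi(X)$ by $\bar\pi\mapsto H(\rho^e;-)$ with $e$ idempotent, $\pi_e=\pi$, and $A\mapsto H(\sigma^e;-)$ with $e$ idempotent, $\mathrm{Im}\,e=A$; on morphisms, $\eta^*$ gives $\rho^a\mapsto\rho^{\eta a}$ and $f$ gives $\sigma^a\mapsto\sigma^{af}$. **Proposition.** Let $\theta$ be a permutation of $X$. Let $\Gamma_\theta\colon\Pi(X)\to\Pi(X)$ be the functor $\bar\pi\mapsto\overline{\theta^{-1}(\pi)}$,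 $\eta^*\mapsto(\theta\eta\theta^{-1})^*$, and let $\Delta_\theta\colon\mathscr P(X)\to\mathscr P(X)$ be the functor $A\mapsto\theta(A)$, $f\mapsto\theta^{-1}f\theta$. Consider the bifunctors $\mathscr P(X)\times\Pi(X)\to\mathbf{Set}$ $$\Gamma_\theta(A,\bar\pi)=\{a\in Sing(X):\mathrm{Im}\,a\subseteq A,\ \bar\pi_a\subseteq\Gamma_\theta(\bar\pi)\},\qquad \Gamma_\theta(f,v^*)\colon a\mapsto uaf,\quad u^*=\Gamma_\theta(v^*),$$ $$\Delta_\theta(A,\bar\pi)=\{a\in Sing(X):\mathrm{Im}\,a\subseteq\Delta_\theta(A),\ \bar\pi_a\subseteq\bar\pi\},\qquad \Delta_\theta(f,v^*)\colon a\mapsto vag,\quad g=\Delta_\theta(f).$$ Then $\chi(A,\bar\pi)\colon a\mapsto\theta^{-1}a\theta$ defines a natural isomorphism $\chi\colon\Gamma_\theta(-,-)\to\Delta_\theta(-,-)$. Moreover, regarding $\Gamma_\theta$ and $\Delta_\theta$ as functors $\Pi(X)\to N^*\mathscr P(X)$ and $\mathscr P(X)\to N^*\Pi(X)$ by the maps above,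 and identifying the elements $a$ of $\Gamma_\theta(A,\bar\pi)$ with $\rho^a$ and those of $\Delta_\theta(A,\bar\pi)$ with $\sigma^a$, both are cross-connections, $\Delta_\theta$ is the unique dual cross-connection of $\Gamma_\theta$, and $\chi$ is the unique associated duality. -/

import Mathlib

open CategoryTheory

universe u

namespace CrossConn

/-! ### Categories with subobjects -/

/-- A small category with a choice of subobjects: a partial order `Sub` on the objects together
with a coherent choice of one morphism (the inclusion `j(c,d)`) for each related pair `c ⊆ d`; the
inclusions form a subcategory of monomorphisms, and `h j = j'` with `j, j'` inclusions forces `h`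
to be an inclusion. -/
class SubobjectCategory (C : Type u) [SmallCategory C] where
  Sub : C → C → Prop
  sub_refl : ∀ c, Sub c c
  sub_trans : ∀ {b c d}, Sub b c → Sub c d → Sub b d
  sub_antisymm : ∀ {c d}, Sub c d → Sub d c → c = d
  incl : ∀ {c d : C}, Sub c d → (c ⟶ d)
  incl_refl : ∀ c, incl (sub_refl c) = 𝟙 c
  incl_comp : ∀ {b c d} (h : Sub b c) (k : Sub c d), incl h ≫ incl k = incl (sub_trans h k)
  incl_mono : ∀ {c d} (h : Sub c d), Mono (incl h)
  incl_factor : ∀ {b c d} (h : Sub b d) (k : Sub c d) (g : b ⟶ c), g ≫ incl k = incl h →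
    ∃ l : Sub b c, g = incl l


/-- A normal factorization `f = e u j`: `e` is a retraction of `c` onto a subobject `c'`, `u` is an
isomorphism of `c'` onto a subobject `d'` of `d`, and `j = j(d',d)`. -/
structure NormalFactorization {C : Type u} [SmallCategory C] [SubobjectCategory C] {c d : C}
    (f : c ⟶ d) where
  source : C
  target : C
  source_sub : SubobjectCategory.Sub source c
  target_sub : SubobjectCategory.Sub target d
  e : c ⟶ source
  u : source ⟶ target
  retraction : SubobjectCategory.incl source_sub ≫ e = 𝟙 source
  isIso : IsIso u
  fac : e ≫ u ≫ SubobjectCategory.incl target_sub = f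

/-! ### Cones and normal categories -/

/-- A cone with base the set of all objects: components `γ(c) : c ⟶ vertex` compatible with the
inclusions. -/
structure SubCone (C : Type u) [SmallCategory C] [SubobjectCategory C] where
  vertex : C
  app : ∀ c : C, c ⟶ vertex
  compat : ∀ {c d : C} (h : SubobjectCategory.Sub c d), SubobjectCategory.incl h ≫ app d = app c

/-- A cone is normal if one of its components is an isomorphism. -/
def SubCone.IsNormal {C : Type u} [SmallCategory C] [SubobjectCategory C] (γ : SubCone C) : Prop :=
  ∃ c, IsIso (γ.app c)

/-- A normal category. -/
class NormalCategory (C : Type u) [SmallCategory C] extends SubobjectCategory C where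
  exists_factorization : ∀ {c d : C} (f : c ⟶ d), Nonempty (NormalFactorization f)
  incl_splits : ∀ {c d : C} (h : Sub c d), ∃ e : d ⟶ c, incl h ≫ e = 𝟙 c
  exists_cone : ∀ c : C, ∃ γ : SubCone C, γ.IsNormal ∧
    ∃ h : γ.vertex = c, γ.app c = eqToHom h.symm

section
open SubobjectCategory

variable {C : Type u} [SmallCategory C] [NormalCategory C]

/-- The image of a morphism: the object `d'` in a normal factorization. -/
noncomputable def im {c d : C} (f : c ⟶ d) : C :=
  (NormalCategory.exists_factorization f).some.target

theorem im_sub {c d : C} (f : c ⟶ d) : Sub (im f) d :=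
  (NormalCategory.exists_factorization f).some.target_sub

/-- The epimorphic component `f° = e u` of a morphism `f = e u j`. It does not depend on the
normal factorization, see `epi_unique`. -/
noncomputable def epi {c d : C} (f : c ⟶ d) : c ⟶ im f :=
  (NormalCategory.exists_factorization f).some.e ≫ (NormalCategory.exists_factorization f).some.u

theorem epi_incl {c d : C} (f : c ⟶ d) : epi f ≫ incl (im_sub f) = f := by
  exact (Category.assoc _ _ _).trans (NormalCategory.exists_factorization f).some.fac

theorem epi_split {c d : C} (f : c ⟶ d) : ∃ s : im f ⟶ c, s ≫ epi f = 𝟙 _ := by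
  have key : ∀ F : NormalFactorization f, ∃ s : F.target ⟶ c, s ≫ F.e ≫ F.u = 𝟙 _ := by
    intro F
    have := F.isIso
    refine ⟨inv F.u ≫ incl F.source_sub, ?_⟩
    rw [Category.assoc, ← Category.assoc (incl _), F.retraction, Category.id_comp,
      IsIso.inv_hom_id]
  exact key _

theorem epi_unique {c d m : C} (f : c ⟶ d) (h : Sub m d) (q : c ⟶ m) (s : m ⟶ c)
    (hs : s ≫ q = 𝟙 m) (hq : q ≫ incl h = f) : ∃ e : im f = m, epi f ≫ eqToHom e = q := by
  obtain ⟨t, ht⟩ := epi_split f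
  have h1 : (t ≫ q) ≫ incl h = incl (im_sub f) := by
    calc (t ≫ q) ≫ incl h = t ≫ f := by rw [Category.assoc, hq]
      _ = t ≫ epi f ≫ incl (im_sub f) := by rw [epi_incl]
      _ = _ := by rw [← Category.assoc, ht, Category.id_comp]
  have h2 : (s ≫ epi f) ≫ incl (im_sub f) = incl h := by
    rw [Category.assoc, epi_incl, ← hq, ← Category.assoc, hs, Category.id_comp]
  obtain ⟨l1, -⟩ := incl_factor _ _ _ h1
  obtain ⟨l2, -⟩ := incl_factor _ _ _ h2
  have e : im f = m := sub_antisymm l1 l2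
  refine ⟨e, ?_⟩
  subst e
  have := incl_mono h
  rw [← cancel_mono (incl h), hq]
  simpa using epi_incl f

/-- The cone `γ * f`, with components `γ(c) f`. -/
def SubCone.star (γ : SubCone C) {d : C} (f : γ.vertex ⟶ d) : SubCone C where
  vertex := d
  app c := γ.app c ≫ f
  compat h := by rw [← Category.assoc, γ.compat]

/-- The product `γ · σ = γ * (σ(c_γ))°` of cones. -/
noncomputable def SubCone.mul (γ σ : SubCone C) : SubCone C :=
  γ.star (epi (σ.app γ.vertex))

/-- The idempotent normal cones, i.e. the idempotents of the semigroup of normal cones. -/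
def SubCone.IsIdempotentNormal (γ : SubCone C) : Prop :=
  γ.IsNormal ∧ γ.mul γ = γ

theorem SubCone.star_epi (γ : SubCone C) {d m : C} (f : γ.vertex ⟶ d) (h : Sub m d)
    (q : γ.vertex ⟶ m) (s : m ⟶ γ.vertex) (hs : s ≫ q = 𝟙 m) (hq : q ≫ incl h = f) :
    γ.star (epi f) = γ.star q := by
  obtain ⟨e, he⟩ := epi_unique f h q s hs hq
  subst e
  simp only [eqToHom_refl, Category.comp_id] at he
  rw [he]

/-! ### `H`-functors and the normal dual -/

/-- The set `H(γ;c) = {γ * f° : f : c_γ ⟶ c}` of cones. -/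
def SubCone.hset (γ : SubCone C) (c : C) : Set (SubCone C) :=
  {x | ∃ f : γ.vertex ⟶ c, x = γ.star (epi f)}

/-- The effect of `g : c ⟶ d` on a cone `x` whose vertex is a subobject of `c`. By
`SubCone.act_star` it sends `γ * f°` to `γ * (f g)°`, whatever the cone `γ` is. -/
noncomputable def SubCone.act (x : SubCone C) {c d : C} (h : Sub x.vertex c) (g : c ⟶ d) :
    SubCone C :=
  x.star (epi (incl h ≫ g))

theorem epi_comp {b c d : C} (f : b ⟶ c) (g : c ⟶ d) (h : Sub (im f) c) :
    ∃ s : im (incl h ≫ g) ⟶ b, s ≫ epi f ≫ epi (incl h ≫ g) = 𝟙 _ ∧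
      (epi f ≫ epi (incl h ≫ g)) ≫ incl (im_sub _) = f ≫ g := by
  obtain ⟨s, hs⟩ := epi_split f
  obtain ⟨t, ht⟩ := epi_split (incl h ≫ g)
  refine ⟨t ≫ s, ?_, ?_⟩
  · rw [Category.assoc, ← Category.assoc s, hs, Category.id_comp, ht]
  · rw [Category.assoc, epi_incl, ← Category.assoc, epi_incl]

theorem SubCone.act_star (γ : SubCone C) {c d : C} (f : γ.vertex ⟶ c) (g : c ⟶ d)
    (h : Sub (γ.star (epi f)).vertex c) :
    (γ.star (epi f)).act h g = γ.star (epi (f ≫ g)) := by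
  obtain ⟨s, hs, hq⟩ := epi_comp f g h
  rw [γ.star_epi (f ≫ g) _ _ s hs hq]
  simp [SubCone.act, SubCone.star]

variable (C) in
/-- The objects of the normal dual: the functors `H(ε;-)`, `ε` an idempotent normal cone. Such a
functor is determined by its values, since its effect on morphisms is `SubCone.act`. -/
@[ext]
structure NormalDual where
  sets : C → Set (SubCone C)
  exists_cone : ∃ ε : SubCone C, ε.IsIdempotentNormal ∧ ∀ c, sets c = ε.hset c

/-- `F = H(ε;-)` with `ε` an idempotent normal cone. -/
def NormalDual.IsGeneratedBy (F : NormalDual C) (ε : SubCone C) : Prop :=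
  ε.IsIdempotentNormal ∧ ∀ c, F.sets c = ε.hset c

theorem NormalDual.sub_of_mem (F : NormalDual C) {c : C} {x : SubCone C} (hx : x ∈ F.sets c) :
    Sub x.vertex c := by
  obtain ⟨ε, -, h⟩ := F.exists_cone
  rw [h] at hx
  obtain ⟨f, rfl⟩ := hx
  exact im_sub f

theorem NormalDual.act_mem (F : NormalDual C) {c d : C} {x : SubCone C} (hx : x ∈ F.sets c)
    (g : c ⟶ d) : x.act (F.sub_of_mem hx) g ∈ F.sets d := by
  obtain ⟨ε, -, h⟩ := F.exists_cone
  have hx' := hx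
  rw [h] at hx'
  obtain ⟨f, rfl⟩ := hx'
  rw [ε.act_star, h]
  exact ⟨f ≫ g, rfl⟩

/-- The underlying set-valued functor `H(ε;-)`. -/
noncomputable def NormalDual.toFunctor (F : NormalDual C) : C ⥤ Type u where
  obj c := F.sets c
  map g := TypeCat.ofHom fun x => ⟨x.1.act (F.sub_of_mem x.2) g, F.act_mem x.2 g⟩
  map_id c := by
    ext ⟨x, hx⟩
    obtain ⟨ε, -, h⟩ := F.exists_cone
    have hx' := hx
    rw [h] at hx'
    obtain ⟨f, rfl⟩ := hx'
    change (ε.star (epi f)).act _ (𝟙 c) = ε.star (epi f)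
    rw [ε.act_star, Category.comp_id]
  map_comp {c d e} g k := by
    ext ⟨x, hx⟩
    obtain ⟨ε, -, h⟩ := F.exists_cone
    have hx' := hx
    rw [h] at hx'
    obtain ⟨f, rfl⟩ := hx'
    change (ε.star (epi f)).act _ (g ≫ k) = ((ε.star (epi f)).act _ g).act _ k
    have key : ∀ y (hy : y = ε.star (epi (f ≫ g))) (p : Sub y.vertex d),
        y.act p k = ε.star (epi ((f ≫ g) ≫ k)) := by
      rintro y rfl p
      exact ε.act_star _ _ _
    rw [key _ (ε.act_star f g _), ε.act_star, Category.assoc]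

/-- Morphisms of the normal dual are the natural transformations. -/
noncomputable instance : SmallCategory (NormalDual C) where
  Hom F G := F.toFunctor ⟶ G.toFunctor
  id F := 𝟙 F.toFunctor
  comp α β := NatTrans.vcomp α β

/-- The full embedding of the normal dual into the category of set-valued functors. -/
noncomputable def NormalDual.forget (C : Type u) [SmallCategory C] [NormalCategory C] :
    NormalDual C ⥤ (C ⥤ Type u) where
  obj F := F.toFunctor
  map α := α

/-- The inclusion of a subfunctor. -/
noncomputable def NormalDual.inclusion {F G : NormalDual C} (h : ∀ c, F.sets c ⊆ G.sets c) :
    F ⟶ G :=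
  (({ app := fun c => TypeCat.ofHom fun x => ⟨x.1, h c x.2⟩ } : F.toFunctor ⟶ G.toFunctor))

/-- In the normal dual, the subobjects of a functor are its subfunctors. -/
noncomputable instance : SubobjectCategory (NormalDual C) where
  Sub F G := ∀ c, F.sets c ⊆ G.sets c
  sub_refl F c := le_rfl
  sub_trans h k c := (h c).trans (k c)
  sub_antisymm h k := NormalDual.ext (funext fun c => (h c).antisymm (k c))
  incl h := NormalDual.inclusion h
  incl_refl F := rfl
  incl_comp h k := rfl
  incl_mono {F G} h := ⟨fun {E} α β hαβ => by
    apply NatTrans.ext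
    funext c
    ext x
    have := congrArg (fun t : E.toFunctor ⟶ G.toFunctor => ((t.app c) x).1) hαβ
    exact Subtype.ext this⟩
  incl_factor {E F G} h k α hα := by
    have key : ∀ c (x : E.sets c), ((NatTrans.app (F := E.toFunctor) (G := F.toFunctor) α c) x).1
        = x.1 := by
      intro c x
      exact congrArg (fun t : E.toFunctor ⟶ G.toFunctor => ((t.app c) x).1) hα
    refine ⟨fun c x hx => ?_, ?_⟩
    · have := key c ⟨x, hx⟩
      rw [← show _ = x from this]
      exact Subtype.property _
    · apply NatTrans.ext
      funext c
      ext x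
      exact Subtype.ext (key c x)

/-- The `M`-set of an `H`-functor `F = H(ε;-)`: the objects at which the component of `ε` is an
isomorphism. -/
def NormalDual.mset (F : NormalDual C) : Set C :=
  {c | ∃ ε : SubCone C, F.IsGeneratedBy ε ∧ IsIso (ε.app c)}

end

/-! ### Cross-connections and duality -/

section
open SubobjectCategory

/-- A local isomorphism: an inclusion preserving, fully faithful functor that restricts, for every
object `c`, to an isomorphism from the full subcategory of the subobjects of `c` onto the full
subcategory of the subobjects of `F(c)` (for a fully faithful functor: a bijection between the
objects of the two). -/
structure IsLocalIso {C D : Type u} [SmallCategory C] [SmallCategory D] [SubobjectCategory C]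
    [SubobjectCategory D] (F : C ⥤ D) : Prop where
  map_sub : ∀ {c d : C} (h : Sub c d), ∃ k : Sub (F.obj c) (F.obj d), F.map (incl h) = incl k
  full : F.Full
  faithful : F.Faithful
  ideal : ∀ c : C, Set.BijOn F.obj {b | Sub b c} {b | Sub b (F.obj c)}

variable {C D : Type u} [SmallCategory C] [SmallCategory D] [NormalCategory C] [NormalCategory D]

/-- `(D, C; Γ)` is a cross-connection from `D` to `C`. -/
structure IsCrossConnection (Γ : D ⥤ NormalDual C) : Prop where
  isLocalIso : IsLocalIso Γ
  exists_mem_mset : ∀ c : C, ∃ d : D, c ∈ (Γ.obj d).mset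

/-- The bifunctor `Γ(-,-) : C × D ⥤ Set`, `Γ(c,d) = Γ(d)(c)`, of a functor `Γ : D ⥤ N*C`. -/
noncomputable def bifunctorLeft (Γ : D ⥤ NormalDual C) : C × D ⥤ Type u :=
  CategoryTheory.Prod.swap C D ⋙ Functor.uncurry.obj (Γ ⋙ NormalDual.forget C)

/-- The bifunctor `Δ(-,-) : C × D ⥤ Set`, `Δ(c,d) = Δ(c)(d)`, of a functor `Δ : C ⥤ N*D`. -/
noncomputable def bifunctorRight (Δ : C ⥤ NormalDual D) : C × D ⥤ Type u :=
  Functor.uncurry.obj (Δ ⋙ NormalDual.forget D)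

/-- The cone in `C` underlying an element of `Γ(c,d)`. -/
def coneLeft {Γ : D ⥤ NormalDual C} {c : C} {d : D} (x : (bifunctorLeft Γ).obj (c, d)) :
    SubCone C :=
  (show (Γ.obj d).sets c from x).1

/-- The cone in `D` underlying an element of `Δ(c,d)`. -/
def coneRight {Δ : C ⥤ NormalDual D} {c : C} {d : D} (x : (bifunctorRight Δ).obj (c, d)) :
    SubCone D :=
  (show (Δ.obj c).sets d from x).1

/-- `Δ` is a dual cross-connection of the cross-connection `Γ`, with associated duality `χ`:
`c ∈ MΓ(d)` if and only if `d ∈ MΔ(c)`, and `χ` is a natural isomorphism `Γ(-,-) ≅ Δ(-,-)` which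
sends the idempotent cone `γ(c,d)` with vertex `c` and `Γ(d) = H(γ(c,d);-)` to the idempotent cone
`δ(c,d)` with vertex `d` and `Δ(c) = H(δ(c,d);-)`, whenever `c ∈ MΓ(d)`. -/
structure IsDuality (Γ : D ⥤ NormalDual C) (Δ : C ⥤ NormalDual D)
    (χ : bifunctorLeft Γ ≅ bifunctorRight Δ) : Prop where
  left : IsCrossConnection Γ
  right : IsCrossConnection Δ
  mem_mset_iff : ∀ (c : C) (d : D), c ∈ (Γ.obj d).mset ↔ d ∈ (Δ.obj c).mset
  map_idempotent : ∀ (c : C) (d : D) (x : (bifunctorLeft Γ).obj (c, d)),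
    (coneLeft x).vertex = c → (Γ.obj d).IsGeneratedBy (coneLeft x) →
      (coneRight (χ.hom.app (c, d) x)).vertex = d ∧
        (Δ.obj c).IsGeneratedBy (coneRight (χ.hom.app (c, d) x))

end

end CrossConn

namespace CrossConn
open SubobjectCategory

theorem SubCone.isIdempotentNormal_of_app {C : Type u} [SmallCategory C] [NormalCategory C]
    (γ : SubCone C) (h : γ.app γ.vertex = 𝟙 _) : γ.IsIdempotentNormal := by
  refine ⟨⟨γ.vertex, by rw [h]; infer_instance⟩, ?_⟩
  have := γ.star_epi (γ.app γ.vertex) (sub_refl _) (𝟙 _) (𝟙 _) (by simp) (by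
    rw [incl_refl, h]; simp)
  rw [SubCone.mul, this]
  simp [SubCone.star]

/-! ### The powerset category -/

/-- The objects of the powerset category of `X`: the non-empty proper subsets of `X`. -/
@[ext]
structure PowersetCat (X : Type u) where
  set : Set X
  nonempty : set.Nonempty
  ne_univ : set ≠ Set.univ

/-- The morphisms from `A` to `B` are all the functions from `A` to `B`. -/
instance (X : Type u) : SmallCategory (PowersetCat X) where
  Hom A B := A.set → B.set
  id A := fun x => x
  comp f g := fun x => g (f x)

namespace PowersetCat

variable {X : Type u}

theorem isIso_of_bijective {A B : PowersetCat X} (f : A ⟶ B)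
    (h : Function.Bijective (f : A.set → B.set)) : IsIso f := by
  let e := Equiv.ofBijective (f : A.set → B.set) h
  exact ⟨⟨(e.symm : B.set → A.set), funext fun x => e.symm_apply_apply x,
    funext fun x => e.apply_symm_apply x⟩⟩

/-- The subobjects are given by the inclusions of subsets. -/
instance : SubobjectCategory (PowersetCat X) where
  Sub A B := A.set ⊆ B.set
  sub_refl A := le_rfl
  sub_trans h k := h.trans k
  sub_antisymm h k := PowersetCat.ext (h.antisymm k)
  incl h := fun x => ⟨x.1, h x.2⟩
  incl_refl A := rfl
  incl_comp h k := rfl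
  incl_mono {A B} h := ⟨fun {E} f g hfg => by
    funext x
    have := congrArg (fun t : E ⟶ B => (t x).1) hfg
    exact Subtype.ext this⟩
  incl_factor {A B D} h k g hg := by
    have key : ∀ x : A.set, (g x).1 = x.1 := fun x =>
      congrArg (fun t : A ⟶ D => (t x).1) hg
    exact ⟨fun x hx => (congrArg (· ∈ B.set) (key ⟨x, hx⟩)).mp (g ⟨x, hx⟩).2, funext fun x => Subtype.ext (key x)⟩

/-- The subset of an object that contains the values of a function. -/
def ofSubset (A : PowersetCat X) (S : Set X) (hS : S.Nonempty) (h : S ⊆ A.set) :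
    PowersetCat X where
  set := S
  nonempty := hS
  ne_univ e := A.ne_univ (Set.univ_subset_iff.1 (e ▸ h))

theorem exists_factorization {A B : PowersetCat X} (f : A ⟶ B) :
    Nonempty (NormalFactorization f) := by
  classical
  have : Nonempty A.set := A.nonempty.to_subtype
  let f' : A.set → B.set := f
  let s : A.set → A.set := fun a => Function.invFun f' (f' a)
  have hs : ∀ a, f' (s a) = f' a := fun a => Function.invFun_eq ⟨a, rfl⟩
  have hs' : ∀ a b, f' a = f' b → s a = s b := fun a b h => by simp only [s, h]
  let S : PowersetCat X := A.ofSubset (Set.range fun a => (s a).1) (Set.range_nonempty _)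
    (by rintro _ ⟨a, rfl⟩; exact (s a).2)
  let T : PowersetCat X := B.ofSubset (Set.range fun a => (f' a).1) (Set.range_nonempty _)
    (by rintro _ ⟨a, rfl⟩; exact (f' a).2)
  have hSA : S.set ⊆ A.set := by rintro _ ⟨a, rfl⟩; exact (s a).2
  let u : S.set → T.set := fun x => ⟨(f' ⟨x.1, hSA x.2⟩).1, ⟨_, rfl⟩⟩
  refine ⟨{
    source := S
    target := T
    source_sub := hSA
    target_sub := by rintro _ ⟨a, rfl⟩; exact (f' a).2
    e := fun a => (⟨(s a).1, ⟨a, rfl⟩⟩ : S.set)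
    u := u
    retraction := ?_
    isIso := ?_
    fac := ?_ }⟩
  · funext x
    obtain ⟨x, a, rfl⟩ := x
    have h := congrArg Subtype.val (hs' _ _ (hs a))
    exact Subtype.ext h
  · refine isIso_of_bijective _ ⟨?_, ?_⟩
    · rintro ⟨_, a, rfl⟩ ⟨_, b, rfl⟩ h
      have h0 : (u _).1 = (u _).1 := congrArg Subtype.val h
      have h' : f' (s a) = f' (s b) := Subtype.ext h0
      rw [hs, hs] at h'
      have h2 := congrArg Subtype.val (hs' _ _ h')
      exact Subtype.ext h2
    · rintro ⟨_, a, rfl⟩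
      have h2 := congrArg Subtype.val (hs a)
      exact ⟨⟨_, a, rfl⟩, Subtype.ext h2⟩
  · funext a
    have h2 := congrArg Subtype.val (hs a)
    exact Subtype.ext h2

theorem exists_retraction (A : PowersetCat X) :
    ∃ e : X → X, (∀ x, e x ∈ A.set) ∧ ∀ x ∈ A.set, e x = x := by
  classical
  obtain ⟨a, ha⟩ := A.nonempty
  refine ⟨fun x => if x ∈ A.set then x else a, fun x => ?_, fun x hx => if_pos hx⟩
  by_cases hx : x ∈ A.set <;> simp [hx, ha]

/-- The cone with vertex `A` defined by a function `a : X → A`: its components are the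
restrictions of `a`. -/
def coneTo (A : PowersetCat X) (a : X → A.set) : SubCone (PowersetCat X) where
  vertex := A
  app _ := fun x => a x.1
  compat _ := rfl

instance : NormalCategory (PowersetCat X) where
  exists_factorization := exists_factorization
  incl_splits {A B} h := by
    obtain ⟨e, he, he'⟩ := A.exists_retraction
    exact ⟨fun x => ⟨e x.1, he _⟩, funext fun x => Subtype.ext (he' _ x.2)⟩
  exists_cone A := by
    obtain ⟨e, he, he'⟩ := A.exists_retraction
    have : (A.coneTo fun x => ⟨e x, he x⟩).app A = 𝟙 A :=
      funext fun x => Subtype.ext (he' _ x.2)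
    exact ⟨A.coneTo fun x => ⟨e x, he x⟩, ⟨A, by rw [this]; exact inferInstanceAs (IsIso (𝟙 A))⟩, rfl, this⟩

end PowersetCat

/-! ### The category of partitions -/

/-- The objects of the category of partitions of `X`: the non-identity partitions `π` of `X`, given
as equivalence relations; the blocks are the elements of `Quotient rel`. The object `π` stands for
the set `π̄` of all the functions from the set of blocks of `π` to `X`. -/
@[ext]
structure PartitionCat (X : Type u) where
  rel : Setoid X
  ne_bot : rel ≠ ⊥

/-- The morphisms from `π̄₁` to `π̄₂` are the maps `η* : π̄₁ → π̄₂`, `α ↦ η α`, where `η` is a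
function from the blocks of `π₂` to the blocks of `π₁`; such a morphism is given by `η`, see
`PartitionCat.star_injective`. -/
instance (X : Type u) : SmallCategory (PartitionCat X) where
  Hom π₁ π₂ := Quotient π₂.rel → Quotient π₁.rel
  id π := fun x => x
  comp f g := fun x => f (g x)

namespace PartitionCat

variable {X : Type u}

/-- The map `η* : π̄₁ → π̄₂`. -/
def star {π₁ π₂ : PartitionCat X} (η : π₁ ⟶ π₂) :
    (Quotient π₁.rel → X) → (Quotient π₂.rel → X) :=
  fun α x => α (η x)

theorem star_comp {π₁ π₂ π₃ : PartitionCat X} (η : π₁ ⟶ π₂) (μ : π₂ ⟶ π₃) :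
    star (η ≫ μ) = star μ ∘ star η := rfl

theorem star_injective [Nontrivial X] (π₁ π₂ : PartitionCat X) :
    Function.Injective (star : (π₁ ⟶ π₂) → _) := by
  classical
  intro η μ h
  obtain ⟨a, b, hab⟩ := exists_pair_ne X
  funext x
  by_contra hx
  have := congrFun (congrFun h fun y => if y = η x then a else b) x
  simp only [star, if_true, if_neg (Ne.symm hx)] at this
  exact hab this

/-- The canonical map from the blocks of a partition to the blocks of a coarser one. -/
def coarsen {r s : Setoid X} (h : r ≤ s) : Quotient r → Quotient s :=
  Quotient.map' (s₁ := r) (s₂ := s) id fun _ _ hxy => h hxy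

theorem coarsen_surjective {r s : Setoid X} (h : r ≤ s) : Function.Surjective (coarsen h) := by
  intro y
  induction y using Quotient.inductionOn with
  | h x => exact ⟨Quotient.mk r x, rfl⟩

theorem isIso_of_bijective {π₁ π₂ : PartitionCat X} (f : π₁ ⟶ π₂)
    (h : Function.Bijective (f : Quotient π₂.rel → Quotient π₁.rel)) : IsIso f := by
  let e := Equiv.ofBijective (f : Quotient π₂.rel → Quotient π₁.rel) h
  exact ⟨⟨(e.symm : Quotient π₁.rel → Quotient π₂.rel), funext fun x => e.apply_symm_apply x,
    funext fun x => e.symm_apply_apply x⟩⟩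

/-- `π̄₁ ⊆ π̄₂` if `π₂` refines `π₁`, and the inclusion is `ν*` where `ν` sends a block of `π₂` to
the block of `π₁` that contains it. -/
instance : SubobjectCategory (PartitionCat X) where
  Sub π₁ π₂ := π₂.rel ≤ π₁.rel
  sub_refl A := le_rfl
  sub_trans h k := le_trans k h
  sub_antisymm h k := PartitionCat.ext (le_antisymm k h)
  incl h := coarsen h
  incl_refl A := funext fun x => Quotient.inductionOn x fun _ => rfl
  incl_comp h k := funext fun x => Quotient.inductionOn x fun _ => rfl
  incl_mono {A B} h := ⟨fun {E} f g hfg => by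
    funext x
    obtain ⟨y, rfl⟩ := coarsen_surjective h x
    exact congrFun hfg y⟩
  incl_factor {A B D} h k g hg := by
    have key : ∀ x : X, g (Quotient.mk _ x) = Quotient.mk _ x := fun x =>
      congrFun hg (Quotient.mk _ x)
    refine ⟨fun {x y} hxy => ?_, funext fun x => Quotient.inductionOn x key⟩
    have e : Quotient.mk B.rel x = Quotient.mk B.rel y := Quotient.sound hxy
    exact Quotient.exact ((key x).symm.trans ((congrArg g e).trans (key y)))

/-- The partition whose blocks are the fibres of a function on the blocks of a given one. -/
def fibres {Y : Type*} (π : PartitionCat X) (f : Quotient π.rel → Y) : PartitionCat X where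
  rel := Setoid.ker fun x => f (Quotient.mk _ x)
  ne_bot h := π.ne_bot (le_bot_iff.1 (h ▸ fun {x y} hxy =>
    congrArg f (Quotient.sound hxy : Quotient.mk π.rel x = Quotient.mk π.rel y)))

theorem le_fibres {Y : Type*} (π : PartitionCat X) (f : Quotient π.rel → Y) :
    π.rel ≤ (π.fibres f).rel := fun {x y} hxy =>
  congrArg f (Quotient.sound hxy : Quotient.mk π.rel x = Quotient.mk π.rel y)

/-- The injective map induced by a function on its fibres. -/
def fibreMap {Y : Type*} (π : PartitionCat X) (f : Quotient π.rel → Y) :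
    Quotient (π.fibres f).rel → Y :=
  Quotient.lift (s := (π.fibres f).rel) (fun x => f (Quotient.mk _ x)) fun _ _ h => h

theorem nonempty_quotient (π : PartitionCat X) : Nonempty (Quotient π.rel) := by
  by_contra h
  refine π.ne_bot (le_bot_iff.1 fun {x y} _ => ?_)
  exact (h ⟨Quotient.mk _ x⟩).elim

theorem exists_factorization {π₁ π₂ : PartitionCat X} (f : π₁ ⟶ π₂) :
    Nonempty (NormalFactorization f) := by
  classical
  have := π₁.nonempty_quotient
  have := π₂.nonempty_quotient
  let η : Quotient π₂.rel → Quotient π₁.rel := f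
  let r : Quotient π₁.rel → Quotient π₁.rel := fun y => η (Function.invFun η y)
  have hr : ∀ x, r (η x) = η x := fun x => Function.invFun_eq ⟨x, rfl⟩
  have hr' : ∀ y, r (r y) = r y := fun y => hr _
  let S := π₁.fibres r
  let T := π₂.fibres η
  let u : Quotient T.rel → Quotient S.rel := fun y => coarsen (π₁.le_fibres r) (π₂.fibreMap η y)
  refine ⟨{
    source := S
    target := T
    source_sub := π₁.le_fibres r
    target_sub := π₂.le_fibres η
    e := π₁.fibreMap r
    u := u
    retraction := ?_
    isIso := ?_
    fac := ?_ }⟩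
  · funext x
    induction x using Quotient.inductionOn with
    | h x =>
      change coarsen (π₁.le_fibres r) (r (Quotient.mk _ x)) = Quotient.mk _ x
      obtain ⟨y, hy⟩ := Quotient.exists_rep (r (Quotient.mk _ x))
      rw [← hy]
      refine Quotient.sound ?_
      change r (Quotient.mk _ y) = r (Quotient.mk _ x)
      rw [hy, hr']
  · refine isIso_of_bijective _ ⟨?_, ?_⟩
    · intro x y
      induction x using Quotient.inductionOn with
      | h x =>
      induction y using Quotient.inductionOn with
      | h y =>
        intro h
        refine Quotient.sound ?_
        change η (Quotient.mk _ x) = η (Quotient.mk _ y)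
        have h' : π₁.fibreMap r (coarsen (π₁.le_fibres r) (η (Quotient.mk _ x))) =
          π₁.fibreMap r (coarsen (π₁.le_fibres r) (η (Quotient.mk _ y))) :=
            congrArg (π₁.fibreMap r) h
        have h2 : ∀ z, π₁.fibreMap r (coarsen (π₁.le_fibres r) z) = r z := fun z =>
          Quotient.inductionOn z fun _ => rfl
        rwa [h2, h2, hr, hr] at h'
    · intro x
      induction x using Quotient.inductionOn with
      | h x =>
        obtain ⟨z, hz⟩ := Quotient.exists_rep (Function.invFun η (Quotient.mk _ x))
        refine ⟨Quotient.mk _ z, ?_⟩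
        change coarsen (π₁.le_fibres r) (η (Quotient.mk _ z)) = Quotient.mk _ x
        have hz' : η (Quotient.mk _ z) = r (Quotient.mk _ x) := congrArg η hz
        rw [hz']
        obtain ⟨y, hy⟩ := Quotient.exists_rep (r (Quotient.mk _ x))
        rw [← hy]
        refine Quotient.sound ?_
        change r (Quotient.mk _ y) = r (Quotient.mk _ x)
        rw [hy, hr']
  · funext x
    induction x using Quotient.inductionOn with
    | h x =>
      have h2 : ∀ z, π₁.fibreMap r (coarsen (π₁.le_fibres r) z) = r z := fun z =>
        Quotient.inductionOn z fun _ => rfl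
      exact (h2 _).trans (hr _)

theorem exists_idempotent (π : PartitionCat X) :
    ∃ e : X → X, Setoid.ker e = π.rel ∧ ∀ x, e (e x) = e x := by
  refine ⟨fun x => (Quotient.mk π.rel x).out, ?_, fun x => ?_⟩
  · ext x y
    change (Quotient.mk π.rel x).out = (Quotient.mk π.rel y).out ↔ π.rel x y
    rw [Quotient.out_inj]
    exact Quotient.eq
  · simp

/-- The cone with vertex `π̄` defined by a transformation `a` that is constant on the blocks of
`π`: its component at `ᾱ` is given by the map sending the block of `x` in `π` to the block of
`(x)a` in `α`. -/
def coneTo (π : PartitionCat X) (a : X → X) (h : π.rel ≤ Setoid.ker a) :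
    SubCone (PartitionCat X) where
  vertex := π
  app α := Quotient.lift (s := π.rel) (fun x => Quotient.mk α.rel (a x))
    fun _ _ hxy => congrArg _ (h hxy)
  compat _ := funext fun x => Quotient.inductionOn x fun _ => rfl

instance : NormalCategory (PartitionCat X) where
  exists_factorization := exists_factorization
  incl_splits {A B} h := by
    refine ⟨fun x => Quotient.mk _ x.out, funext fun x => ?_⟩
    exact Quotient.out_eq x
  exists_cone π := by
    obtain ⟨e, he, he'⟩ := π.exists_idempotent
    have : (π.coneTo e he.ge).app π = 𝟙 π := by
      funext x
      induction x using Quotient.inductionOn with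
      | h x => exact Quotient.sound (he ▸ he' x)
    exact ⟨π.coneTo e he.ge, ⟨π, by rw [this]; exact inferInstanceAs (IsIso (𝟙 π))⟩, rfl, this⟩

end PartitionCat
end CrossConn

namespace CrossConn
open SubobjectCategory

variable {X : Type u}

/-! ### Singular transformations -/

/-- `Sing(X)`: the non-invertible transformations of `X`. -/
def Sing (X : Type u) : Set (X → X) :=
  {a | ¬ Function.Bijective a}

/-- `{a ∈ Sing(X) : Im a ⊆ A, π̄_a ⊆ π̄}`, where `π_a` is the partition of `X` induced by `a`. -/
def transSet (A : PowersetCat X) (π : PartitionCat X) : Set (X → X) :=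
  {a | a ∈ Sing X ∧ Set.range a ⊆ A.set ∧ π.rel ≤ Setoid.ker a}

/-- The map on the blocks of `π` induced by `a`. -/
def descend {A : PowersetCat X} {π : PartitionCat X} (a : transSet A π) (y : Quotient π.rel) :
    A.set :=
  Quotient.lift (s := π.rel) (fun x => (⟨a.1 x, a.2.2.1 ⟨x, rfl⟩⟩ : A.set))
    (fun _ _ h => Subtype.ext (a.2.2.2 h)) y

theorem mem_transSet {A : PowersetCat X} {π : PartitionCat X} {a : X → X}
    (h1 : ∀ x, a x ∈ A.set) (h2 : π.rel ≤ Setoid.ker a) : a ∈ transSet A π := by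
  refine ⟨fun h => A.ne_univ ?_, by rintro _ ⟨x, rfl⟩; exact h1 x, h2⟩
  rw [Set.eq_univ_iff_forall]
  intro y
  obtain ⟨x, rfl⟩ := h.2 y
  exact h1 x

/-- The map `a ↦ u a f`, where `u` is a function from the blocks of `π'` to the blocks of `π` and
`f : A → B`: a point `x` goes to its block in `π'`, then to a block in `π` by `u`, then to a point
of `A` by `a`, then to `B` by `f`. -/
def transMap {A B : PowersetCat X} {π π' : PartitionCat X} (f : A ⟶ B) (u : π ⟶ π')
    (a : transSet A π) : transSet B π' :=
  ⟨fun x => (f (descend a (u (Quotient.mk _ x)))).1,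
    mem_transSet (fun _ => Subtype.property _) fun {x y} hxy =>
      congrArg (fun t => (f (descend a (u t))).1)
        (Quotient.sound hxy : Quotient.mk π'.rel x = Quotient.mk π'.rel y)⟩

theorem descend_transMap {A B : PowersetCat X} {π π' : PartitionCat X} (f : A ⟶ B) (u : π ⟶ π')
    (a : transSet A π) (y : Quotient π'.rel) :
    descend (transMap f u a) y = f (descend a (u y)) :=
  Quotient.inductionOn y fun _ => rfl

/-- The bifunctor `(A,π̄) ↦ {a ∈ Sing(X) : Im a ⊆ A, π̄_a ⊆ π̄}`, `(f,u*) ↦ (a ↦ u a f)`. -/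
def transBifunctor (X : Type u) : PowersetCat X × PartitionCat X ⥤ Type u where
  obj P := transSet P.1 P.2
  map g := TypeCat.ofHom (transMap g.1 g.2)
  map_id P := by
    ext a x
    rfl
  map_comp g k := by
    ext a x
    exact (congrArg (fun t => (k.1 t).1) (descend_transMap g.1 g.2 a _)).symm

/-- The bifunctor associated with a functor `Γ : Π(X) ⥤ Π(X)`:
`Γ(A,π̄) = {a ∈ Sing(X) : Im a ⊆ A, π̄_a ⊆ Γ(π̄)}` and `Γ(f,v*) : a ↦ u a f` with `u* = Γ(v*)`. -/
def gammaBifunctor (Γ : PartitionCat X ⥤ PartitionCat X) :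
    PowersetCat X × PartitionCat X ⥤ Type u :=
  (𝟭 (PowersetCat X)).prod Γ ⋙ transBifunctor X

/-- The bifunctor associated with a functor `Δ : 𝒫(X) ⥤ 𝒫(X)`:
`Δ(A,π̄) = {a ∈ Sing(X) : Im a ⊆ Δ(A), π̄_a ⊆ π̄}` and `Δ(f,v*) : a ↦ v a g` with `g = Δ(f)`. -/
def deltaBifunctor (Δ : PowersetCat X ⥤ PowersetCat X) :
    PowersetCat X × PartitionCat X ⥤ Type u :=
  Δ.prod (𝟭 (PartitionCat X)) ⋙ transBifunctor X

/-- The transformation underlying an element of `Γ(A,π̄)`. -/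
def gammaTrans {Γ : PartitionCat X ⥤ PartitionCat X} {A : PowersetCat X} {π : PartitionCat X}
    (a : (gammaBifunctor Γ).obj (A, π)) : X → X :=
  (show transSet A (Γ.obj π) from a).1

/-- The transformation underlying an element of `Δ(A,π̄)`. -/
def deltaTrans {Δ : PowersetCat X ⥤ PowersetCat X} {A : PowersetCat X} {π : PartitionCat X}
    (a : (deltaBifunctor Δ).obj (A, π)) : X → X :=
  (show transSet (Δ.obj A) π from a).1

/-! ### The functors induced by a permutation -/

/-- The functor `θ` on the powerset category: `A ↦ θ(A)` and `f ↦ θ⁻¹ f θ` (composition from left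
to right). -/
def powersetPerm (θ : Equiv.Perm X) : PowersetCat X ⥤ PowersetCat X where
  obj A :=
    { set := θ '' A.set
      nonempty := A.nonempty.image θ
      ne_univ := fun h => A.ne_univ (by
        rw [← Set.preimage_image_eq A.set θ.injective, h, Set.preimage_univ]) }
  map {A B} f := fun y =>
    ⟨θ (f ⟨θ.symm y.1, Set.mem_image_equiv.1 y.2⟩).1, _, Subtype.property _, rfl⟩
  map_id A := funext fun y => Subtype.ext (θ.apply_symm_apply _)
  map_comp f g := by
    funext y
    refine Subtype.ext ?_
    exact congrArg (fun t => θ (g t).1) (Subtype.ext (θ.symm_apply_apply _).symm)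

/-- The partition `θ⁻¹(σ)`, whose blocks are the preimages `θ⁻¹(B)` of the blocks `B` of `σ`. -/
def preimagePartition (θ : Equiv.Perm X) (σ : PartitionCat X) : PartitionCat X where
  rel := Setoid.comap θ σ.rel
  ne_bot h := σ.ne_bot (le_bot_iff.1 fun {x y} hxy => by
    have : Setoid.comap θ σ.rel (θ.symm x) (θ.symm y) := by
      rw [Setoid.comap_rel]; simpa using hxy
    rw [h] at this
    exact θ.symm.injective this)

/-- `θ` as a bijection from the blocks of `θ⁻¹(σ)` to the blocks of `σ`. -/
def blockEquiv (θ : Equiv.Perm X) (σ : PartitionCat X) :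
    Quotient (preimagePartition θ σ).rel ≃ Quotient σ.rel where
  toFun := Quotient.map' (s₁ := (preimagePartition θ σ).rel) (s₂ := σ.rel) θ fun _ _ h => h
  invFun := Quotient.map' (s₁ := σ.rel) (s₂ := (preimagePartition θ σ).rel) θ.symm
    fun x y h => by
      change σ.rel (θ (θ.symm x)) (θ (θ.symm y))
      simpa using h
  left_inv y := Quotient.inductionOn y fun x => congrArg (Quotient.mk _) (θ.symm_apply_apply x)
  right_inv y := Quotient.inductionOn y fun x => congrArg (Quotient.mk _) (θ.apply_symm_apply x)

/-- The functor `θ` on the category of partitions: `σ̄ ↦ θ⁻¹(σ)` (barred) and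
`η* ↦ (θ η θ⁻¹)*` (composition from left to right). -/
def partitionPerm (θ : Equiv.Perm X) : PartitionCat X ⥤ PartitionCat X where
  obj σ := preimagePartition θ σ
  map {σ₁ σ₂} η := fun y => (blockEquiv θ σ₁).symm (η (blockEquiv θ σ₂ y))
  map_id σ := funext fun y => (blockEquiv θ σ).symm_apply_apply y
  map_comp {σ₁ σ₂ σ₃} η μ := by
    funext y
    change _ = (blockEquiv θ σ₁).symm (η (blockEquiv θ σ₂ ((blockEquiv θ σ₂).symm _)))
    rw [Equiv.apply_symm_apply]
    rfl

/-! ### Normal cones defined by singular transformations -/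

/-- The image of a transformation, as an object of the powerset category. -/
def imageObj [Nonempty X] (a : X → X) (h : Set.range a ≠ Set.univ) : PowersetCat X :=
  ⟨Set.range a, Set.range_nonempty a, h⟩

/-- The cone `ρ^a` in the powerset category defined by a transformation `a`: its vertex is `Im a`
and its components are the restrictions of `a`. -/
def rho [Nonempty X] (a : X → X) (h : Set.range a ≠ Set.univ) : SubCone (PowersetCat X) :=
  (imageObj a h).coneTo fun x => ⟨a x, x, rfl⟩

/-- The cone `σ^a` in the category of partitions defined by a transformation `a`: its vertex is
`π̄_a`, and its component at `ᾱ` is given by the map sending the block of `x` in `π_a` to the block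
of `(x)a` in `α`. -/
def sigma (a : X → X) (h : Setoid.ker a ≠ ⊥) : SubCone (PartitionCat X) :=
  (⟨Setoid.ker a, h⟩ : PartitionCat X).coneTo a le_rfl

theorem range_ne_univ {A : PowersetCat X} {π : PartitionCat X} (a : transSet A π) :
    Set.range a.1 ≠ Set.univ := fun h => A.ne_univ (Set.univ_subset_iff.1 (h ▸ a.2.2.1))

theorem ker_ne_bot {A : PowersetCat X} {π : PartitionCat X} (a : transSet A π) :
    Setoid.ker a.1 ≠ ⊥ := fun h => π.ne_bot (le_bot_iff.1 (h ▸ a.2.2.2))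

/-- `a ↦ ρ^a` on `transSet A π`. -/
def rhoCone [Nonempty X] {A : PowersetCat X} {π : PartitionCat X} (a : transSet A π) :
    SubCone (PowersetCat X) :=
  rho a.1 (range_ne_univ a)

/-- `a ↦ σ^a` on `transSet A π`. -/
def sigmaCone {A : PowersetCat X} {π : PartitionCat X} (a : transSet A π) :
    SubCone (PartitionCat X) :=
  sigma a.1 (ker_ne_bot a)

theorem SubCone.star_eq {C : Type u} [SmallCategory C] [NormalCategory C] (γ δ : SubCone C)
    (q : γ.vertex ⟶ δ.vertex) (h : ∀ c, γ.app c ≫ q = δ.app c) : γ.star q = δ := by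
  obtain ⟨v, t, ht⟩ := δ
  change γ.vertex ⟶ v at q
  have : t = fun c => γ.app c ≫ q := funext fun c => (h c).symm
  subst this
  rfl

theorem rhoCone_injective [Nontrivial X] (A : PowersetCat X) (π : PartitionCat X) :
    Function.Injective (rhoCone : transSet A π → _) := by
  intro a b h
  refine Subtype.ext (funext fun x => ?_)
  obtain ⟨y, hy⟩ := exists_ne x
  let S : PowersetCat X := ⟨{x}, ⟨x, rfl⟩, fun e => hy (e.symm ▸ Set.mem_univ y : y ∈ ({x} : Set X))⟩
  exact congrArg (fun γ : SubCone (PowersetCat X) => (γ.app S ⟨x, rfl⟩).1) h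

theorem PowersetCat.exists_separating (A : PowersetCat X) : ∃ e : X → X, (∀ x, e x ∈ A.set) ∧
    (∀ x ∈ A.set, e x = x) ∧ Setoid.ker e ≠ ⊥ := by
  obtain ⟨e, he, he'⟩ := A.exists_retraction
  refine ⟨e, he, he', fun h => A.ne_univ (Set.eq_univ_iff_forall.2 fun x => ?_)⟩
  have : Setoid.ker e (e x) x := he' _ (he x)
  rw [h] at this
  have e1 : e x = x := this
  exact e1 ▸ he x

theorem sigmaCone_injective (A : PowersetCat X) (π : PartitionCat X) :
    Function.Injective (sigmaCone : transSet A π → _) := by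
  intro a b h
  obtain ⟨e, he, he', hk⟩ := A.exists_separating
  have key : ∀ (γ δ : SubCone (PartitionCat X)), γ = δ → ∀ x, γ.app ⟨Setoid.ker e, hk⟩
      (Quotient.mk _ x) = δ.app ⟨Setoid.ker e, hk⟩ (Quotient.mk _ x) := by
    rintro γ _ rfl x
    rfl
  refine Subtype.ext (funext fun x => ?_)
  have h1 : Quotient.mk (Setoid.ker e) (a.1 x) = Quotient.mk (Setoid.ker e) (b.1 x) := key _ _ h x
  have h2 : e (a.1 x) = e (b.1 x) := Quotient.exact h1
  rwa [he' _ (a.2.2.1 ⟨x, rfl⟩), he' _ (b.2.2.1 ⟨x, rfl⟩)] at h2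

theorem rho_star_epi [Nonempty X] (a : X → X) (h : Set.range a ≠ Set.univ) {B : PowersetCat X}
    (f : imageObj a h ⟶ B) (h' : Set.range (fun x => (f ⟨a x, x, rfl⟩).1) ≠ Set.univ) :
    (rho a h).star (epi f) = rho (fun x => (f ⟨a x, x, rfl⟩).1) h' := by
  let q : imageObj a h ⟶ imageObj _ h' := fun y => ⟨(f y).1, by
    obtain ⟨_, x, rfl⟩ := y
    exact ⟨x, rfl⟩⟩
  have hq : Function.Surjective (q : (imageObj a h).set → (imageObj _ h').set) := by
    rintro ⟨_, x, rfl⟩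
    exact ⟨⟨a x, x, rfl⟩, rfl⟩
  exact (rho a h).star_epi f (m := imageObj _ h')
    (by rintro _ ⟨x, rfl⟩; exact Subtype.property _) q (Function.surjInv hq)
    (funext fun y => Function.surjInv_eq hq y) rfl

/-- The injective map on the blocks of `π_a` induced by `a`. -/
def kerMap (a : X → X) : Quotient (Setoid.ker a) → X :=
  Quotient.lift (s := Setoid.ker a) a fun _ _ h => h

theorem kerMap_injective (a : X → X) : Function.Injective (kerMap a) := by
  intro x y
  induction x using Quotient.inductionOn
  induction y using Quotient.inductionOn
  exact fun h => Quotient.sound h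

theorem sigma_star_epi (a : X → X) (h : Setoid.ker a ≠ ⊥) {π : PartitionCat X}
    (f : (sigma a h).vertex ⟶ π)
    (h' : Setoid.ker (fun x => kerMap a (f (Quotient.mk _ x))) ≠ ⊥) :
    (sigma a h).star (epi f) = sigma (fun x => kerMap a (f (Quotient.mk _ x))) h' := by
  let b : X → X := fun x => kerMap a (f (Quotient.mk _ x))
  let m : PartitionCat X := ⟨Setoid.ker b, h'⟩
  have hm : Sub m π := fun {x y} hxy => congrArg (fun t => kerMap a (f t))
    (Quotient.sound hxy : Quotient.mk π.rel x = Quotient.mk π.rel y)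
  let q : Quotient (Setoid.ker b) → Quotient (Setoid.ker a) :=
    Quotient.lift (s := Setoid.ker b) (fun x => f (Quotient.mk _ x))
      fun _ _ hxy => kerMap_injective a hxy
  have hq : Function.Injective q := by
    intro x y
    induction x using Quotient.inductionOn
    induction y using Quotient.inductionOn
    exact fun h => Quotient.sound (congrArg (kerMap a) h)
  have : Nonempty (Quotient (Setoid.ker b)) := m.nonempty_quotient
  rw [(sigma a h).star_epi f (m := m) hm q (Function.invFun q)
    (funext fun y => Function.leftInverse_invFun hq y)
    (funext fun y => Quotient.inductionOn y fun _ => rfl)]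
  have key : ∀ α : PartitionCat X,
      CategoryStruct.comp (Y := (sigma a h).vertex) (Z := m) ((sigma a h).app α) q =
        (sigma b h').app α := by
    intro α
    funext y
    induction y using Quotient.inductionOn with
    | h x =>
      change (sigma a h).app α (f (Quotient.mk _ x)) =
        Quotient.mk _ (kerMap a (f (Quotient.mk _ x)))
      exact Quotient.inductionOn (f (Quotient.mk _ x)) fun _ => rfl
  exact SubCone.star_eq (sigma a h) (sigma b h') q key

end CrossConn

namespace CrossConn
open SubobjectCategory

variable {X : Type u}

/-! ### The normal duals of the two categories -/

/-- The `H`-functor of the powerset category that corresponds to a partition `π`: it is `H(ρ^e;-)`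
for every idempotent transformation `e` with `π_e = π`, and its value at `A` consists of the cones
`ρ^a` with `Im a ⊆ A` and `π̄_a ⊆ π̄`. -/
def powersetDual [Nontrivial X] (π : PartitionCat X) : NormalDual (PowersetCat X) where
  sets A := Set.range (rhoCone : transSet A π → _)
  exists_cone := by
    obtain ⟨e, he, he'⟩ := π.exists_idempotent
    have hr : Set.range e ≠ Set.univ := fun h => π.ne_bot (le_bot_iff.1 fun {x y} hxy => by
      have hid : ∀ x, e x = x := fun x => by
        obtain ⟨z, rfl⟩ := (h.symm ▸ Set.mem_univ x : x ∈ Set.range e)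
        exact he' z
      have h2 : e x = e y := he.ge hxy
      rwa [hid, hid] at h2)
    refine ⟨rho e hr, SubCone.isIdempotentNormal_of_app _ ?_, fun A => ?_⟩
    · funext y
      obtain ⟨_, x, rfl⟩ := y
      exact Subtype.ext (he' x)
    · apply Set.Subset.antisymm
      · rintro _ ⟨a, rfl⟩
        refine ⟨fun y => ⟨a.1 y.1, a.2.2.1 ⟨_, rfl⟩⟩, ?_⟩
        have hae : (fun x => a.1 (e x)) = a.1 := funext fun x =>
          a.2.2.2 (he.le (he' x : Setoid.ker e (e x) x))
        refine Eq.trans ?_ (rho_star_epi e hr (B := A) _ ?_).symm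
        · change rho a.1 _ = rho (fun x => a.1 (e x)) _
          simp only [hae]
        · change Set.range (fun x => a.1 (e x)) ≠ Set.univ
          rw [hae]
          exact range_ne_univ a
      · rintro _ ⟨f, rfl⟩
        have hm : (fun x => (f ⟨e x, x, rfl⟩).1) ∈ transSet A π :=
          mem_transSet (fun _ => Subtype.property _) fun {x y} hxy => by
            have h2 : e x = e y := he.ge hxy
            change (f ⟨e x, x, rfl⟩).1 = (f ⟨e y, y, rfl⟩).1
            simp only [h2]
        exact ⟨⟨_, hm⟩, (rho_star_epi e hr (B := A) f (range_ne_univ ⟨_, hm⟩)).symm⟩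

/-- The `H`-functor of the category of partitions that corresponds to a subset `A`: it is
`H(σ^e;-)` for every idempotent transformation `e` with `Im e = A`, and its value at `π̄` consists of
the cones `σ^a` with `Im a ⊆ A` and `π̄_a ⊆ π̄`. -/
def partitionDual (A : PowersetCat X) : NormalDual (PartitionCat X) where
  sets π := Set.range (sigmaCone : transSet A π → _)
  exists_cone := by
    obtain ⟨e, he, he', hk⟩ := A.exists_separating
    have hmap : ∀ y, kerMap e y ∈ A.set := fun y => Quotient.inductionOn y fun x => he x
    have hmk : ∀ y, Quotient.mk (Setoid.ker e) (kerMap e y) = y := fun y =>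
      Quotient.inductionOn y fun x => Quotient.sound (he' _ (he x))
    refine ⟨sigma e hk, SubCone.isIdempotentNormal_of_app _ ?_, fun π => ?_⟩
    · funext y
      exact Quotient.inductionOn y fun x => Quotient.sound (he' _ (he x))
    · apply Set.Subset.antisymm
      · rintro _ ⟨a, rfl⟩
        have hae : (fun x => kerMap e (Quotient.mk (Setoid.ker e) (a.1 x))) = a.1 :=
          funext fun x => he' _ (a.2.2.1 ⟨x, rfl⟩)
        refine ⟨fun y => Quotient.mk (Setoid.ker e) (descend a y).1, ?_⟩
        refine Eq.trans ?_ (sigma_star_epi e hk (π := π) _ ?_).symm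
        · change sigma a.1 _ = sigma (fun x => kerMap e (Quotient.mk (Setoid.ker e) (a.1 x))) _
          simp only [hae]
        · change Setoid.ker (fun x => kerMap e (Quotient.mk (Setoid.ker e) (a.1 x))) ≠ ⊥
          rw [hae]
          exact ker_ne_bot a
      · rintro _ ⟨f, rfl⟩
        have hm : (fun x => kerMap e (f (Quotient.mk _ x))) ∈ transSet A π :=
          mem_transSet (fun _ => hmap _) fun {x y} hxy =>
            congrArg (fun t => kerMap e (f t))
              (Quotient.sound hxy : Quotient.mk π.rel x = Quotient.mk π.rel y)
        exact ⟨⟨_, hm⟩, (sigma_star_epi e hk f (ker_ne_bot ⟨_, hm⟩)).symm⟩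

theorem rhoCone_act [Nontrivial X] {A B : PowersetCat X} {π : PartitionCat X} (a : transSet A π)
    (f : A ⟶ B) (h : Sub (rhoCone a).vertex A) :
    (rhoCone a).act h f = rhoCone (transMap f (𝟙 π) a) :=
  rho_star_epi a.1 (range_ne_univ a) (incl h ≫ f) (range_ne_univ (transMap f (𝟙 π) a))

theorem sigmaCone_act {A : PowersetCat X} {π π' : PartitionCat X} (a : transSet A π)
    (u : π ⟶ π') (h : Sub (sigmaCone a).vertex π) :
    (sigmaCone a).act h u = sigmaCone (transMap (𝟙 A) u a) := by
  have e : (fun x => kerMap a.1 ((incl h ≫ u) (Quotient.mk π'.rel x))) =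
      (transMap (𝟙 A) u a).1 := by
    funext x
    change kerMap a.1 (PartitionCat.coarsen h (u (Quotient.mk _ x))) =
      (descend a (u (Quotient.mk _ x))).1
    exact Quotient.inductionOn (u (Quotient.mk _ x)) fun _ => rfl
  have h' := ker_ne_bot (transMap (𝟙 A) u a)
  rw [← e] at h'
  refine (sigma_star_epi a.1 (ker_ne_bot a) (incl h ≫ u) h').trans ?_
  simp only [sigmaCone]
  congr 1

/-- The element `ρ^a` of `H(ρ^e;A)`, as a bijection from `{a : Im a ⊆ A, π̄_a ⊆ π̄}`. -/
noncomputable def rhoEquiv [Nontrivial X] (A : PowersetCat X) (π : PartitionCat X) :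
    transSet A π ≃ (powersetDual π).sets A :=
  Equiv.ofInjective _ (rhoCone_injective A π)

/-- The element `σ^a` of `H(σ^e;π̄)`, as a bijection from `{a : Im a ⊆ A, π̄_a ⊆ π̄}`. -/
noncomputable def sigmaEquiv (A : PowersetCat X) (π : PartitionCat X) :
    transSet A π ≃ (partitionDual A).sets π :=
  Equiv.ofInjective _ (sigmaCone_injective A π)

theorem transMap_id {A : PowersetCat X} {π : PartitionCat X} (a : transSet A π) :
    transMap (𝟙 A) (𝟙 π) a = a := rfl

theorem transMap_comp {A B D : PowersetCat X} {π π' π'' : PartitionCat X} (f : A ⟶ B) (g : B ⟶ D)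
    (u : π ⟶ π') (v : π' ⟶ π'') (a : transSet A π) :
    transMap (f ≫ g) (u ≫ v) a = transMap g v (transMap f u a) :=
  Subtype.ext (funext fun _ => (congrArg (fun t => (g t).1) (descend_transMap f u a _)).symm)

/-- The functor `Q : Π(X) ⥤ N*𝒫(X)` identifying the category of partitions with the normal dual of
the powerset category: `π̄ ↦ H(ρ^e;-)` with `π_e = π`, and `η*` goes to the natural transformation
`ρ^a ↦ ρ^{η a}`. -/
noncomputable def toPowersetDual (X : Type u) [Nontrivial X] :
    PartitionCat X ⥤ NormalDual (PowersetCat X) where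
  obj π := powersetDual π
  map {π π'} η :=
    show (powersetDual π).toFunctor ⟶ (powersetDual π').toFunctor from
    { app := fun A => TypeCat.ofHom fun x =>
        rhoEquiv A π' (transMap (𝟙 A) η ((rhoEquiv A π).symm x))
      naturality := fun A B f => by
        ext x
        obtain ⟨a, rfl⟩ := (rhoEquiv A π).surjective x
        have h1 : ∀ (σ : PartitionCat X) (b : transSet A σ),
            (powersetDual σ).toFunctor.map f (rhoEquiv A σ b) =
              rhoEquiv B σ (transMap f (𝟙 σ) b) :=
          fun σ b => Subtype.ext (rhoCone_act b f _)
        change rhoEquiv B π' (transMap (𝟙 B) η ((rhoEquiv B π).symm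
          ((powersetDual π).toFunctor.map f (rhoEquiv A π a)))) =
          (powersetDual π').toFunctor.map f
            (rhoEquiv A π' (transMap (𝟙 A) η ((rhoEquiv A π).symm (rhoEquiv A π a))))
        rw [h1, h1, Equiv.symm_apply_apply, Equiv.symm_apply_apply, ← transMap_comp,
          ← transMap_comp]
        rfl }
  map_id π := by
    apply NatTrans.ext
    funext A
    ext x
    exact (rhoEquiv A π).apply_symm_apply x
  map_comp {π π' π''} η μ := by
    apply NatTrans.ext
    funext A
    ext x
    change rhoEquiv A π'' (transMap (𝟙 A) (η ≫ μ) ((rhoEquiv A π).symm x)) =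
      rhoEquiv A π'' (transMap (𝟙 A) μ ((rhoEquiv A π').symm
        (rhoEquiv A π' (transMap (𝟙 A) η ((rhoEquiv A π).symm x)))))
    rw [Equiv.symm_apply_apply, ← transMap_comp]
    rfl

/-- The functor `𝒫(X) ⥤ N*Π(X)` identifying subsets with `H`-functors of the category of
partitions: `A ↦ H(σ^e;-)` with `Im e = A`, and `f` goes to the natural transformation
`σ^a ↦ σ^{a f}`. -/
noncomputable def toPartitionDual (X : Type u) : PowersetCat X ⥤ NormalDual (PartitionCat X) where
  obj A := partitionDual A
  map {A B} f :=
    show (partitionDual A).toFunctor ⟶ (partitionDual B).toFunctor from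
    { app := fun π => TypeCat.ofHom fun x =>
        sigmaEquiv B π (transMap f (𝟙 π) ((sigmaEquiv A π).symm x))
      naturality := fun π π' u => by
        ext x
        obtain ⟨a, rfl⟩ := (sigmaEquiv A π).surjective x
        have h1 : ∀ (S : PowersetCat X) (b : transSet S π),
            (partitionDual S).toFunctor.map u (sigmaEquiv S π b) =
              sigmaEquiv S π' (transMap (𝟙 S) u b) :=
          fun S b => Subtype.ext (sigmaCone_act b u _)
        change sigmaEquiv B π' (transMap f (𝟙 π') ((sigmaEquiv A π').symm
          ((partitionDual A).toFunctor.map u (sigmaEquiv A π a)))) =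
          (partitionDual B).toFunctor.map u
            (sigmaEquiv B π (transMap f (𝟙 π) ((sigmaEquiv A π).symm (sigmaEquiv A π a))))
        rw [h1, h1, Equiv.symm_apply_apply, Equiv.symm_apply_apply, ← transMap_comp,
          ← transMap_comp]
        rfl }
  map_id A := by
    apply NatTrans.ext
    funext π
    ext x
    exact (sigmaEquiv A π).apply_symm_apply x
  map_comp {A B D} f g := by
    apply NatTrans.ext
    funext π
    ext x
    change sigmaEquiv D π (transMap (f ≫ g) (𝟙 π) ((sigmaEquiv A π).symm x)) =
      sigmaEquiv D π (transMap g (𝟙 π) ((sigmaEquiv B π).symm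
        (sigmaEquiv B π (transMap f (𝟙 π) ((sigmaEquiv A π).symm x)))))
    rw [Equiv.symm_apply_apply, ← transMap_comp]
    rfl

/-- `Γ_θ`, as a functor from `Π(X)` to the normal dual of `𝒫(X)`. -/
noncomputable def gammaPerm [Nontrivial X] (θ : Equiv.Perm X) :
    PartitionCat X ⥤ NormalDual (PowersetCat X) :=
  partitionPerm θ ⋙ toPowersetDual X

/-- `Δ_θ`, as a functor from `𝒫(X)` to the normal dual of `Π(X)`. -/
noncomputable def deltaPerm (θ : Equiv.Perm X) : PowersetCat X ⥤ NormalDual (PartitionCat X) :=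
  powersetPerm θ ⋙ toPartitionDual X

/-- The identification `a ↦ ρ^a` of the elements of `Γ(A,π̄)`, for `Γ : Π(X) ⥤ Π(X)`, with the
elements of the bifunctor of `Γ` as a functor to the normal dual of `𝒫(X)`. -/
noncomputable def gammaCone [Nontrivial X] (Γ : PartitionCat X ⥤ PartitionCat X) :
    gammaBifunctor Γ ≅ bifunctorLeft (Γ ⋙ toPowersetDual X) :=
  NatIso.ofComponents (fun P => (rhoEquiv P.1 (Γ.obj P.2)).toIso) fun {P P'} g => by
    ext a
    change transSet P.1 (Γ.obj P.2) at a
    have h1 : ∀ b : transSet P.1 (Γ.obj P'.2),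
        (powersetDual (Γ.obj P'.2)).toFunctor.map g.1 (rhoEquiv P.1 (Γ.obj P'.2) b) =
          rhoEquiv P'.1 (Γ.obj P'.2) (transMap g.1 (𝟙 _) b) :=
      fun b => Subtype.ext (rhoCone_act b g.1 _)
    change rhoEquiv P'.1 (Γ.obj P'.2) (transMap g.1 (Γ.map g.2) a) =
      (powersetDual (Γ.obj P'.2)).toFunctor.map g.1 (rhoEquiv P.1 (Γ.obj P'.2)
        (transMap (𝟙 _) (Γ.map g.2) ((rhoEquiv P.1 (Γ.obj P.2)).symm
          (rhoEquiv P.1 (Γ.obj P.2) a))))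
    rw [h1, Equiv.symm_apply_apply, ← transMap_comp]
    rfl

/-- The identification `a ↦ σ^a` of the elements of `Δ(A,π̄)`, for `Δ : 𝒫(X) ⥤ 𝒫(X)`, with the
elements of the bifunctor of `Δ` as a functor to the normal dual of `Π(X)`. -/
noncomputable def deltaCone (Δ : PowersetCat X ⥤ PowersetCat X) :
    deltaBifunctor Δ ≅ bifunctorRight (Δ ⋙ toPartitionDual X) :=
  NatIso.ofComponents (fun P => (sigmaEquiv (Δ.obj P.1) P.2).toIso) fun {P P'} g => by
    ext a
    change transSet (Δ.obj P.1) P.2 at a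
    have h1 : ∀ b : transSet (Δ.obj P'.1) P.2,
        (partitionDual (Δ.obj P'.1)).toFunctor.map g.2 (sigmaEquiv (Δ.obj P'.1) P.2 b) =
          sigmaEquiv (Δ.obj P'.1) P'.2 (transMap (𝟙 _) g.2 b) :=
      fun b => Subtype.ext (sigmaCone_act b g.2 _)
    change sigmaEquiv (Δ.obj P'.1) P'.2 (transMap (Δ.map g.1) g.2 a) =
      (partitionDual (Δ.obj P'.1)).toFunctor.map g.2 (sigmaEquiv (Δ.obj P'.1) P.2
        (transMap (Δ.map g.1) (𝟙 _) ((sigmaEquiv (Δ.obj P.1) P.2).symm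
          (sigmaEquiv (Δ.obj P.1) P.2 a))))
    rw [h1, Equiv.symm_apply_apply, ← transMap_comp]
    rfl

/-- The identifications of the two descriptions of the bifunctors act by `a ↦ ρ^a`, `a ↦ σ^a`. -/
theorem coneLeft_gammaCone [Nontrivial X] (Γ : PartitionCat X ⥤ PartitionCat X)
    (A : PowersetCat X) (π : PartitionCat X) (a : (gammaBifunctor Γ).obj (A, π)) :
    coneLeft ((gammaCone Γ).hom.app (A, π) a) =
      rhoCone (A := A) (π := Γ.obj π) a := rfl

theorem coneRight_deltaCone (Δ : PowersetCat X ⥤ PowersetCat X)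
    (A : PowersetCat X) (π : PartitionCat X) (a : (deltaBifunctor Δ).obj (A, π)) :
    coneRight ((deltaCone Δ).hom.app (A, π) a) =
      sigmaCone (A := Δ.obj A) (π := π) a := rfl

end CrossConn

open CrossConn

/-!
Since `ε` is idempotent, the functor `H(ε;-)` is represented by the vertex of `ε` (Yoneda), so a
natural transformation out of it is determined by its value at the cone `ε`. For the functors
attached to a partition `π` or to a subset `A`, the idempotent generating cones are the `ρ^e` and
`σ^e` with `e` a projection: `e` is idempotent with fibres the blocks of `π`, respectively with
image `A`. Hence `A ∈ MΓ_θ(π̄)` and `π̄ ∈ MΔ_θ(A)` say that there is a projection with image `A`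
along `θ⁻¹(π)`, respectively with image `θ(A)` along `π`, and conjugation by `θ` exchanges the two
kinds. This is the duality.

For uniqueness, two dualities of `Γ_θ` compose to a natural transformation
`ψ : Δ_θ(-,-) ⟶ Δ(-,-)` preserving idempotent generating cones, and it suffices that `ψ` fixes the
underlying cones. Precomposing `σ^a` with a constant map onto the block of `z`, and using that
inclusions are preserved, one sees that what the component of `ψ(σ^a)` at `β` does to the block of
`z` depends only on the point `(z)a`. It may thus be computed with `a` replaced by a projection
along `β` fixing `(z)a`; there `ψ` yields an idempotent cone with vertex `β`, whose component at `β`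
is the identity, so the value is the block of `(z)a`, as it is for `σ^a` itself.
-/

namespace CrossConn
open SubobjectCategory

section NormalCategory

variable {C : Type u} [SmallCategory C] [NormalCategory C]

theorem incl_eq_eqToHom {c d : C} (h : Sub c d) (e : c = d) : incl h = eqToHom e := by
  subst e
  exact incl_refl c

namespace SubCone

theorem app_comp_eqToHom {γ δ : SubCone C} (h : γ = δ) (c : C) :
    γ.app c ≫ eqToHom (congrArg vertex h) = δ.app c := by
  subst h
  exact Category.comp_id _

theorem star_id (γ : SubCone C) : γ.star (𝟙 _) = γ :=
  γ.star_eq γ (𝟙 _) fun _ => Category.comp_id _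

theorem star_star (γ : SubCone C) {c d : C} (f : γ.vertex ⟶ c) (g : c ⟶ d) :
    (γ.star f).star g = γ.star (f ≫ g) :=
  SubCone.star_eq (γ.star f) (γ.star (f ≫ g)) g fun _ => Category.assoc _ _ _

theorem star_epi_id (γ : SubCone C) : γ.star (epi (𝟙 γ.vertex)) = γ := by
  rw [γ.star_epi (𝟙 _) (sub_refl _) (𝟙 _) (𝟙 _) (Category.comp_id _)
    (by rw [incl_refl, Category.comp_id]), star_id]

theorem star_star_epi (γ : SubCone C) {c d : C} (u : γ.vertex ⟶ c) [IsIso u] (f : c ⟶ d) :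
    (γ.star u).star (epi f) = γ.star (epi (u ≫ f)) := by
  obtain ⟨s, hs⟩ := epi_split f
  rw [γ.star_epi (u ≫ f) (im_sub f) (u ≫ epi f) (s ≫ inv u) (by simpa using hs)
    (by rw [Category.assoc, epi_incl])]
  exact γ.star_star u (epi f)

theorem hset_star (γ : SubCone C) {c : C} (u : γ.vertex ⟶ c) [IsIso u] (d : C) :
    (γ.star u).hset d = γ.hset d := by
  ext x
  constructor
  · rintro ⟨f, rfl⟩
    exact ⟨u ≫ f, γ.star_star_epi u f⟩
  · rintro ⟨f, rfl⟩
    have hstar := γ.star_star_epi u (inv u ≫ f)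
    rw [IsIso.hom_inv_id_assoc] at hstar
    exact ⟨(inv u ≫ f : c ⟶ d), hstar.symm⟩

theorem IsIdempotentNormal.app_vertex {γ : SubCone C} (h : γ.IsIdempotentNormal) :
    γ.app γ.vertex = 𝟙 _ := by
  obtain ⟨⟨c, _⟩, hmul⟩ := h
  have hvertex : im (γ.app γ.vertex) = γ.vertex := congrArg vertex hmul
  calc γ.app γ.vertex = epi (γ.app γ.vertex) ≫ eqToHom hvertex := by
        rw [← incl_eq_eqToHom (im_sub _), epi_incl]
    _ = 𝟙 _ := by
        rw [← cancel_epi (γ.app c), Category.comp_id, ← Category.assoc]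
        exact app_comp_eqToHom hmul c

end SubCone

namespace NormalDual

/-- The effect of `F = H(ε;-)` on a morphism, as a function between sets of cones. -/
noncomputable def map (F : NormalDual C) {c d : C} (g : c ⟶ d) (x : F.sets c) : F.sets d :=
  ⟨x.1.act (F.sub_of_mem x.2) g, F.act_mem x.2 g⟩

/-- The component at `c` of a morphism of the normal dual, as a function between sets of cones. -/
def app {F G : NormalDual C} (τ : F ⟶ G) {c : C} (x : F.sets c) : G.sets c :=
  NatTrans.app (F := F.toFunctor) (G := G.toFunctor) τ c x

theorem app_map {F G : NormalDual C} (τ : F ⟶ G) {c d : C} (g : c ⟶ d) (x : F.sets c) :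
    app τ (F.map g x) = G.map g (app τ x) :=
  NatTrans.naturality_apply (F := F.toFunctor) (G := G.toFunctor) τ g x

theorem map_id_apply (F : NormalDual C) {c : C} (x : F.sets c) : F.map (𝟙 c) x = x :=
  F.toFunctor.map_id_apply c x

theorem map_val_congr {F G : NormalDual C} {c d : C} {x : F.sets c} {y : G.sets c}
    (h : x.1 = y.1) (g : c ⟶ d) : (F.map g x).1 = (G.map g y).1 := by
  simp only [map, h]

theorem hom_ext {F G : NormalDual C} {τ τ' : F ⟶ G}
    (h : ∀ (c : C) (x : F.sets c), app τ x = app τ' x) : τ = τ' := by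
  apply NatTrans.ext
  funext c
  ext x
  exact h c x

theorem app_eqToHom {F G : NormalDual C} (h : F = G) {c : C} (x : F.sets c) :
    (app (eqToHom h) x).1 = x.1 := by
  subst h
  rfl

theorem isGeneratedBy_of_map_surjective {F : NormalDual C} {c₀ : C} (x₀ : F.sets c₀)
    (hid : x₀.1.app x₀.1.vertex = 𝟙 _)
    (h : ∀ c, Function.Surjective fun f : c₀ ⟶ c => F.map f x₀) : F.IsGeneratedBy x₀.1 := by
  refine ⟨x₀.1.isIdempotentNormal_of_app hid, fun c => Set.Subset.antisymm ?_ ?_⟩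
  · intro x hx
    obtain ⟨f, hf⟩ := h c ⟨x, hx⟩
    exact ⟨_, (congrArg Subtype.val hf).symm⟩
  · rintro _ ⟨f, rfl⟩
    obtain ⟨r, hr⟩ := NormalCategory.incl_splits (F.sub_of_mem x₀.2)
    have hmem : x₀.1.act (F.sub_of_mem x₀.2) (r ≫ f) ∈ F.sets c := F.act_mem x₀.2 (r ≫ f)
    rwa [SubCone.act, ← Category.assoc, hr, Category.id_comp] at hmem

namespace IsGeneratedBy

variable {F G : NormalDual C} {ε δ : SubCone C}

theorem mem (h : F.IsGeneratedBy ε) : ε ∈ F.sets ε.vertex := by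
  rw [h.2]
  exact ⟨𝟙 _, ε.star_epi_id.symm⟩

theorem map_surjective {c₀ : C} {x₀ : F.sets c₀} (h : F.IsGeneratedBy x₀.1) (c : C) :
    Function.Surjective fun f : c₀ ⟶ c => F.map f x₀ := by
  rintro ⟨x, hx⟩
  rw [h.2] at hx
  obtain ⟨f, rfl⟩ := hx
  obtain ⟨r, hr⟩ := NormalCategory.incl_splits (F.sub_of_mem x₀.2)
  refine ⟨r ≫ f, Subtype.ext ?_⟩
  change x₀.1.act _ (r ≫ f) = _
  rw [SubCone.act, ← Category.assoc, hr, Category.id_comp]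

theorem unique (hF : F.IsGeneratedBy ε) (hG : G.IsGeneratedBy ε) : F = G :=
  NormalDual.ext (funext fun c => (hF.2 c).trans (hG.2 c).symm)

theorem app_injective {c₀ : C} {x₀ : F.sets c₀} (h : F.IsGeneratedBy x₀.1) :
    Function.Injective fun τ : F ⟶ G => app τ x₀ := by
  intro τ τ' hτ
  refine hom_ext fun c x => ?_
  obtain ⟨f, rfl⟩ := h.map_surjective c x
  change app τ (F.map f x₀) = app τ' (F.map f x₀)
  rw [app_map, app_map]
  exact congrArg (G.map f) hτ

theorem eq_of_vertex_eq (hε : F.IsGeneratedBy ε) (hδ : F.IsGeneratedBy δ)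
    (h : δ.vertex = ε.vertex) : δ = ε := by
  have key : ∀ {m : C} (g : ε.vertex ⟶ m), m = ε.vertex → (ε.star g).app m = 𝟙 m →
      ε.star g = ε := by
    rintro _ g rfl hg
    change ε.app ε.vertex ≫ g = 𝟙 _ at hg
    rw [hε.1.app_vertex, Category.id_comp] at hg
    rw [hg, SubCone.star_id]
  have hmem := hδ.mem
  rw [hε.2] at hmem
  obtain ⟨f, hf⟩ := hmem
  have hid := hδ.1.app_vertex
  revert h hid
  rw [hf]
  exact key (epi f)

end IsGeneratedBy

theorem mem_mset_iff {F : NormalDual C} {c : C} :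
    c ∈ F.mset ↔ ∃ ε, F.IsGeneratedBy ε ∧ ε.vertex = c := by
  constructor
  · rintro ⟨ε, hε, _⟩
    have hid : (ε.star (inv (ε.app c))).app c = 𝟙 c := IsIso.hom_inv_id (ε.app c)
    exact ⟨ε.star (inv (ε.app c)), ⟨SubCone.isIdempotentNormal_of_app _ hid,
      fun d => (hε.2 d).trans (ε.hset_star _ d).symm⟩, rfl⟩
  · rintro ⟨ε, hε, rfl⟩
    exact ⟨ε, hε, hε.1.app_vertex ▸ inferInstance⟩

theorem map_bijective_of_isGeneratedBy {D : Type u} [SmallCategory D] {Φ : D ⥤ NormalDual C}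
    {d d' : D} {c : C} {x₀ : (Φ.obj d).sets c} (hgen : (Φ.obj d).IsGeneratedBy x₀.1)
    (h : Function.Bijective fun η : d ⟶ d' => app (Φ.map η) x₀) :
    Function.Bijective (Φ.map : (d ⟶ d') → (Φ.obj d ⟶ Φ.obj d')) :=
  ⟨Function.Injective.of_comp (f := fun τ => app τ x₀) h.1,
    Function.Surjective.of_comp_left (f := fun τ => app τ x₀) h.2 hgen.app_injective⟩

end NormalDual

end NormalCategory

section IsLocalIso

variable {C D : Type u} [SmallCategory C] [SmallCategory D] [SubobjectCategory C]
  [SubobjectCategory D]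

theorem IsLocalIso.of_map_bijective {F : C ⥤ D}
    (map_sub : ∀ {c d : C} (h : Sub c d), ∃ k : Sub (F.obj c) (F.obj d),
      F.map (incl h) = incl k)
    (map_bijective : ∀ c d : C, Function.Bijective (F.map : (c ⟶ d) → (F.obj c ⟶ F.obj d)))
    (sub_of_sub : ∀ {b b' c : C}, Sub b c → Sub b' c → Sub (F.obj b) (F.obj b') → Sub b b')
    (exists_sub : ∀ {c : C} {x : D}, Sub x (F.obj c) → ∃ b, Sub b c ∧ F.obj b = x) :
    IsLocalIso F where
  map_sub := map_sub
  full := ⟨fun {c d} => (map_bijective c d).2⟩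
  faithful := ⟨fun {c d} _ _ h => (map_bijective c d).1 h⟩
  ideal _ := ⟨fun _ hb => (map_sub hb).1,
    fun _ hb _ hb' h => sub_antisymm (sub_of_sub hb hb' (h ▸ sub_refl _))
      (sub_of_sub hb' hb (h ▸ sub_refl _)),
    fun _ hx => exists_sub hx⟩

theorem IsLocalIso.comp {E : Type u} [SmallCategory E] [SubobjectCategory E] {F : C ⥤ D}
    {G : D ⥤ E} (hF : IsLocalIso F) (hG : IsLocalIso G) : IsLocalIso (F ⋙ G) where
  map_sub h := by
    obtain ⟨k, hk⟩ := hF.map_sub h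
    obtain ⟨l, hl⟩ := hG.map_sub k
    exact ⟨l, by rw [Functor.comp_map, hk, hl]⟩
  full :=
    have := hF.full
    have := hG.full
    inferInstance
  faithful :=
    have := hF.faithful
    have := hG.faithful
    inferInstance
  ideal c := (hG.ideal (F.obj c)).comp (hF.ideal c)

end IsLocalIso

section Duality

variable {C D : Type u} [SmallCategory C] [SmallCategory D] [NormalCategory D]
  {Δ Δ' : C ⥤ NormalDual D}

/-- The image of an element of `Δ(c)(d)` under a natural transformation `Δ(-,-) ⟶ Δ'(-,-)`. -/
noncomputable def bifunctorApp (ψ : bifunctorRight Δ ⟶ bifunctorRight Δ') {c : C} {d : D}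
    (x : (Δ.obj c).sets d) : (Δ'.obj c).sets d :=
  ψ.app (c, d) x

theorem bifunctorApp_map (ψ : bifunctorRight Δ ⟶ bifunctorRight Δ') {c : C} {d d' : D}
    (u : d ⟶ d') (x : (Δ.obj c).sets d) :
    bifunctorApp ψ ((Δ.obj c).map u x) = (Δ'.obj c).map u (bifunctorApp ψ x) := by
  have hψ := NatTrans.naturality_apply ψ (Prod.mkHom (𝟙 c) u : (c, d) ⟶ (c, d')) x
  change bifunctorApp ψ ((Δ.obj c).map u (NormalDual.app (Δ.map (𝟙 c)) x)) =
    (Δ'.obj c).map u (NormalDual.app (Δ'.map (𝟙 c)) (bifunctorApp ψ x)) at hψ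
  rwa [Δ.map_id, Δ'.map_id] at hψ

theorem bifunctorApp_app (ψ : bifunctorRight Δ ⟶ bifunctorRight Δ') {c c' : C} {d : D}
    (f : c ⟶ c') (x : (Δ.obj c).sets d) :
    bifunctorApp ψ (NormalDual.app (Δ.map f) x) =
      NormalDual.app (Δ'.map f) (bifunctorApp ψ x) := by
  have hψ := NatTrans.naturality_apply ψ (Prod.mkHom f (𝟙 d) : (c, d) ⟶ (c', d)) x
  change bifunctorApp ψ ((Δ.obj c').map (𝟙 d) (NormalDual.app (Δ.map f) x)) =
    (Δ'.obj c').map (𝟙 d) (NormalDual.app (Δ'.map f) (bifunctorApp ψ x)) at hψ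
  rwa [NormalDual.map_id_apply, NormalDual.map_id_apply] at hψ

theorem bifunctorApp_val_eq_of_isGeneratedBy {ψ : bifunctorRight Δ ⟶ bifunctorRight Δ'} {c : C}
    {d₀ : D} {x₀ : (Δ.obj c).sets d₀} (hgen : (Δ.obj c).IsGeneratedBy x₀.1)
    (hx₀ : (bifunctorApp ψ x₀).1 = x₀.1) {d : D} (x : (Δ.obj c).sets d) :
    (bifunctorApp ψ x).1 = x.1 := by
  obtain ⟨u, rfl⟩ := hgen.map_surjective d x
  change (bifunctorApp ψ ((Δ.obj c).map u x₀)).1 = ((Δ.obj c).map u x₀).1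
  rw [bifunctorApp_map]
  exact NormalDual.map_val_congr hx₀ u

theorem functor_eq_of_bifunctorApp_val_eq (ψ : bifunctorRight Δ ≅ bifunctorRight Δ')
    (h : ∀ (c : C) (d : D) (x : (Δ.obj c).sets d), (bifunctorApp ψ.hom x).1 = x.1) :
    Δ = Δ' := by
  have hobj : ∀ c, Δ.obj c = Δ'.obj c := fun c => by
    refine NormalDual.ext (funext fun d => Set.Subset.antisymm (fun x hx => ?_) fun y hy => ?_)
    · have hval : (bifunctorApp ψ.hom ⟨x, hx⟩).1 = x := h c d ⟨x, hx⟩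
      exact hval ▸ (bifunctorApp ψ.hom ⟨x, hx⟩).2
    · have hinv : bifunctorApp ψ.hom (bifunctorApp ψ.inv ⟨y, hy⟩) = ⟨y, hy⟩ :=
        ψ.inv_hom_id_app_apply (c, d) _
      have hval : (bifunctorApp ψ.inv ⟨y, hy⟩).1 = y :=
        (h c d _).symm.trans (congrArg Subtype.val hinv)
      exact hval ▸ (bifunctorApp ψ.inv ⟨y, hy⟩).2
  refine CategoryTheory.Functor.ext hobj fun c c' f => NormalDual.hom_ext fun d x => Subtype.ext ?_
  have happ : bifunctorApp ψ.hom x = NormalDual.app (eqToHom (hobj c)) x :=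
    Subtype.ext ((h c d x).trans (NormalDual.app_eqToHom _ x).symm)
  calc (NormalDual.app (Δ.map f) x).1
      = (bifunctorApp ψ.hom (NormalDual.app (Δ.map f) x)).1 := (h c' d _).symm
    _ = (NormalDual.app (Δ'.map f) (NormalDual.app (eqToHom (hobj c)) x)).1 := by
        rw [bifunctorApp_app, happ]
    _ = _ := (NormalDual.app_eqToHom (hobj c').symm _).symm

/-- `ψ` sends every idempotent cone with vertex `d` that generates `Δ(c)` to such a cone for
`Δ'(c)`. -/
def PreservesGenerators (ψ : bifunctorRight Δ ⟶ bifunctorRight Δ') : Prop :=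
  ∀ (c : C) (d : D) (x : (Δ.obj c).sets d), x.1.vertex = d → (Δ.obj c).IsGeneratedBy x.1 →
    (bifunctorApp ψ x).1.vertex = d ∧ (Δ'.obj c).IsGeneratedBy (bifunctorApp ψ x).1

theorem IsDuality.preservesGenerators [NormalCategory C] {Γ : D ⥤ NormalDual C}
    {χ : bifunctorLeft Γ ≅ bifunctorRight Δ} {χ' : bifunctorLeft Γ ≅ bifunctorRight Δ'}
    (h : IsDuality Γ Δ χ) (h' : IsDuality Γ Δ' χ') : PreservesGenerators (χ.inv ≫ χ'.hom) := by
  intro c d x hvertex hgen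
  obtain ⟨ε, hε, hεc⟩ := NormalDual.mem_mset_iff.1
    ((h.mem_mset_iff c d).2 (NormalDual.mem_mset_iff.2 ⟨x.1, hgen, hvertex⟩))
  subst hεc
  let y : (bifunctorLeft Γ).obj (ε.vertex, d) := (⟨ε, hε.mem⟩ : (Γ.obj d).sets ε.vertex)
  obtain ⟨hyvertex, hygen⟩ := h.map_idempotent ε.vertex d y rfl hε
  have hy : χ.hom.app (ε.vertex, d) y = x :=
    Subtype.ext (hgen.eq_of_vertex_eq hygen (hyvertex.trans hvertex.symm))
  have hinv : χ.inv.app (ε.vertex, d) x = y := by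
    rw [← hy]
    exact χ.hom_inv_id_app_apply _ y
  change (coneRight (χ'.hom.app _ (χ.inv.app (ε.vertex, d) x))).vertex = d ∧
    (Δ'.obj _).IsGeneratedBy (coneRight (χ'.hom.app _ (χ.inv.app (ε.vertex, d) x)))
  rw [hinv]
  exact h'.map_idempotent ε.vertex d y rfl hε

theorem bifunctorApp_val_eq_of_sub [SubobjectCategory C] (ψ : bifunctorRight Δ ⟶ bifunctorRight Δ')
    (hΔ : IsLocalIso Δ) (hΔ' : IsLocalIso Δ') {c c' : C} (hsub : Sub c c') {d : D}
    {x : (Δ.obj c).sets d} {x' : (Δ.obj c').sets d} (hx : x.1 = x'.1) :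
    (bifunctorApp ψ x).1 = (bifunctorApp ψ x').1 := by
  obtain ⟨k, hk⟩ := hΔ.map_sub hsub
  obtain ⟨k', hk'⟩ := hΔ'.map_sub hsub
  have hincl : NormalDual.app (Δ.map (incl hsub)) x = x' := by
    rw [hk]
    exact Subtype.ext hx
  rw [← hincl, bifunctorApp_app, hk']
  rfl

end Duality

variable {X : Type u}

variable {X : Type u}

/-- `e` is the projection onto `A` along `π`: it is idempotent, has image `A`, and its fibres are
the blocks of `π`. -/
structure IsProjection (e : X → X) (A : PowersetCat X) (π : PartitionCat X) : Prop where
  range_eq : Set.range e = A.set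
  ker_eq : Setoid.ker e = π.rel
  idem : ∀ x, e (e x) = e x

namespace IsProjection

variable {e : X → X} {A : PowersetCat X} {π : PartitionCat X}

theorem mem (h : IsProjection e A π) : e ∈ transSet A π :=
  mem_transSet (fun x => h.range_eq ▸ Set.mem_range_self x) h.ker_eq.ge

theorem apply_of_mem (h : IsProjection e A π) {x : X} (hx : x ∈ A.set) : e x = x := by
  rw [← h.range_eq] at hx
  obtain ⟨y, rfl⟩ := hx
  exact h.idem y

theorem rel_apply (h : IsProjection e A π) (x : X) : π.rel (e x) x :=
  h.ker_eq ▸ (h.idem x : Setoid.ker e (e x) x)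

theorem descend_mk (h : IsProjection e A π) (x : A.set) :
    descend ⟨e, h.mem⟩ (Quotient.mk π.rel x.1) = x :=
  Subtype.ext (h.apply_of_mem x.2)

theorem mk_descend (h : IsProjection e A π) (q : Quotient π.rel) :
    Quotient.mk π.rel (descend ⟨e, h.mem⟩ q).1 = q :=
  Quotient.inductionOn q fun x => Quotient.sound (h.rel_apply x)

theorem transMap_left_bijective (h : IsProjection e A π) (B : PowersetCat X) :
    Function.Bijective fun f : A ⟶ B => transMap f (𝟙 π) ⟨e, h.mem⟩ := by
  constructor
  · intro f g hfg
    funext x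
    have hx := congrArg (fun b => descend b (Quotient.mk π.rel x.1)) hfg
    simp only [descend_transMap] at hx
    change f (descend ⟨e, h.mem⟩ (Quotient.mk π.rel x.1)) =
      g (descend ⟨e, h.mem⟩ (Quotient.mk π.rel x.1)) at hx
    rwa [h.descend_mk] at hx
  · intro b
    exact ⟨fun x => descend b (Quotient.mk π.rel x.1),
      Subtype.ext (funext fun x => b.2.2.2 (h.rel_apply x))⟩

theorem transMap_right_bijective (h : IsProjection e A π) (π' : PartitionCat X) :
    Function.Bijective fun u : π ⟶ π' => transMap (𝟙 A) u ⟨e, h.mem⟩ := by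
  constructor
  · intro u v huv
    funext q
    have hq := congrArg (fun b => Quotient.mk π.rel (descend b q).1) huv
    simp only [descend_transMap] at hq
    exact (h.mk_descend (u q)).symm.trans (hq.trans (h.mk_descend (v q)))
  · intro b
    exact ⟨fun q => Quotient.mk π.rel (descend b q).1,
      Subtype.ext (funext fun x => h.apply_of_mem (b.2.2.1 ⟨x, rfl⟩))⟩

end IsProjection

theorem range_ne_univ_of_idempotent {e : X → X} (idem : ∀ x, e (e x) = e x)
    (h : Setoid.ker e ≠ ⊥) : Set.range e ≠ Set.univ := by
  intro hrange
  refine h ((Setoid.injective_iff_ker_bot e).1 fun x y hxy => ?_)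
  have hid : ∀ x, e x = x := fun x => by
    obtain ⟨z, rfl⟩ := Set.range_eq_univ.1 hrange x
    exact idem z
  rwa [hid, hid] at hxy

theorem PowersetCat.exists_isProjection (A : PowersetCat X) : ∃ e π, IsProjection e A π := by
  obtain ⟨e, hmem, hfix, hker⟩ := A.exists_separating
  exact ⟨e, ⟨_, hker⟩, (Set.range_subset_iff.2 hmem).antisymm fun x hx => ⟨x, hfix x hx⟩, rfl,
    fun x => hfix _ (hmem x)⟩

theorem PartitionCat.exists_isProjection (π : PartitionCat X) (y : X) :
    ∃ e A, IsProjection e A π ∧ y ∈ A.set := by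
  classical
  let s : Quotient π.rel → X := Function.update Quotient.out (Quotient.mk π.rel y) y
  have hs : ∀ q, Quotient.mk π.rel (s q) = q := by
    intro q
    by_cases hq : q = Quotient.mk π.rel y
    · simp only [s, hq, Function.update_self]
    · simp only [s, Function.update_of_ne hq, Quotient.out_eq]
  have hker : Setoid.ker (fun x => s (Quotient.mk π.rel x)) = π.rel := Setoid.ext fun x z =>
    (Function.LeftInverse.injective hs).eq_iff.trans Quotient.eq
  have : Nonempty X := ⟨y⟩
  have hidem : ∀ x, s (Quotient.mk π.rel (s (Quotient.mk π.rel x))) = s (Quotient.mk π.rel x) :=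
    fun x => congrArg s (hs _)
  exact ⟨_, imageObj _ (range_ne_univ_of_idempotent hidem (hker.trans_ne π.ne_bot)),
    ⟨rfl, hker, hidem⟩, y, Function.update_self _ _ _⟩

section Generators

variable {A B : PowersetCat X} {π π' : PartitionCat X}

theorem rhoCone_app_vertex_eq_id_iff [Nonempty X] (a : transSet A π) :
    (rhoCone a).app (rhoCone a).vertex = 𝟙 _ ↔ ∀ x, a.1 (a.1 x) = a.1 x := by
  constructor
  · intro h x
    exact congrArg Subtype.val (congrFun h ⟨a.1 x, x, rfl⟩)
  · intro h
    funext ⟨_, x, rfl⟩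
    exact Subtype.ext (h x)

theorem sigmaCone_app_vertex_eq_id_iff (a : transSet A π) :
    (sigmaCone a).app (sigmaCone a).vertex = 𝟙 _ ↔ ∀ x, a.1 (a.1 x) = a.1 x := by
  constructor
  · intro h x
    exact Quotient.exact (congrFun h (Quotient.mk _ x))
  · intro h
    exact funext fun q => Quotient.inductionOn q fun x => Quotient.sound (h x)

theorem IsProjection.vertex_rhoCone [Nonempty X] {a : transSet A π}
    (h : IsProjection a.1 B π') : (rhoCone a).vertex = B :=
  PowersetCat.ext h.range_eq

theorem IsProjection.vertex_sigmaCone {a : transSet A π} (h : IsProjection a.1 B π') :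
    (sigmaCone a).vertex = π' :=
  PartitionCat.ext h.ker_eq

theorem powersetDual_map_rhoEquiv [Nontrivial X] (f : A ⟶ B) (a : transSet A π) :
    (powersetDual π).map f (rhoEquiv A π a) = rhoEquiv B π (transMap f (𝟙 π) a) :=
  Subtype.ext (rhoCone_act a f _)

theorem partitionDual_map_sigmaEquiv (u : π ⟶ π') (a : transSet A π) :
    (partitionDual A).map u (sigmaEquiv A π a) = sigmaEquiv A π' (transMap (𝟙 A) u a) :=
  Subtype.ext (sigmaCone_act a u _)

theorem IsProjection.isGeneratedBy_rhoCone [Nontrivial X] {a : transSet A π}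
    (h : IsProjection a.1 B π') : (powersetDual π').IsGeneratedBy (rhoCone a) := by
  refine NormalDual.isGeneratedBy_of_map_surjective (rhoEquiv B π' ⟨a.1, h.mem⟩)
    ((rhoCone_app_vertex_eq_id_iff a).2 h.idem) fun B' => ?_
  simp only [powersetDual_map_rhoEquiv]
  exact (rhoEquiv B' π').surjective.comp (h.transMap_left_bijective B').2

theorem IsProjection.isGeneratedBy_sigmaCone {a : transSet A π} (h : IsProjection a.1 B π') :
    (partitionDual B).IsGeneratedBy (sigmaCone a) := by
  refine NormalDual.isGeneratedBy_of_map_surjective (sigmaEquiv B π' ⟨a.1, h.mem⟩)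
    ((sigmaCone_app_vertex_eq_id_iff a).2 h.idem) fun σ => ?_
  simp only [partitionDual_map_sigmaEquiv]
  exact (sigmaEquiv B σ).surjective.comp (h.transMap_right_bijective σ).2

/-- The object `{x}` of the powerset category, which detects the value of a map at `x`. -/
def PowersetCat.singleton [Nontrivial X] (x : X) : PowersetCat X :=
  ⟨{x}, Set.singleton_nonempty x, Set.singleton_ne_univ x⟩

theorem rho_injective [Nontrivial X] {a b : X → X} {ha : Set.range a ≠ Set.univ}
    {hb : Set.range b ≠ Set.univ} (h : rho a ha = rho b hb) : a = b :=
  funext fun x => congrArg (fun γ : SubCone (PowersetCat X) =>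
    (γ.app (PowersetCat.singleton x) ⟨x, rfl⟩).1) h

theorem powersetDual_sub_iff [Nontrivial X] :
    Sub (powersetDual π) (powersetDual π') ↔ Sub π π' := by
  constructor
  · intro h
    obtain ⟨e, A, he, -⟩ := π.exists_isProjection (Classical.arbitrary X)
    obtain ⟨b, hb⟩ := h A ⟨⟨e, he.mem⟩, rfl⟩
    have hbe : b.1 = e := rho_injective hb
    exact b.2.2.2.trans_eq (hbe ▸ he.ker_eq)
  · rintro h A _ ⟨a, rfl⟩
    exact ⟨⟨a.1, a.2.1, a.2.2.1, le_trans h a.2.2.2⟩, rfl⟩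

/-- The bound `B` matters: on a set with two elements all the functors `partitionDual A` agree. -/
theorem partitionDual_sub_iff {A' : PowersetCat X} (hA : Sub A B) (hA' : Sub A' B) :
    Sub (partitionDual A) (partitionDual A') ↔ Sub A A' := by
  constructor
  · intro h
    obtain ⟨e, π, he⟩ := A.exists_isProjection
    obtain ⟨b, hb⟩ := h π ⟨⟨e, he.mem⟩, rfl⟩
    have hbe : b.1 = e := congrArg Subtype.val (sigmaCone_injective B π
      (a₁ := ⟨b.1, b.2.1, b.2.2.1.trans hA', b.2.2.2⟩)
      (a₂ := ⟨e, he.mem.1, he.mem.2.1.trans hA, he.mem.2.2⟩) hb)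
    exact he.range_eq.symm.trans_subset (hbe ▸ b.2.2.1)
  · rintro h π _ ⟨a, rfl⟩
    exact ⟨⟨a.1, a.2.1, a.2.2.1.trans h, a.2.2.2⟩, rfl⟩

theorem exists_powersetDual_eq [Nontrivial X] {F : NormalDual (PowersetCat X)} {a : transSet A π}
    (h : F.IsGeneratedBy (rhoCone a)) :
    ∃ σ, Sub σ π ∧ powersetDual σ = F ∧ IsProjection a.1 (rhoCone a).vertex σ := by
  have hproj : IsProjection a.1 (rhoCone a).vertex ⟨_, ker_ne_bot a⟩ :=
    ⟨rfl, rfl, (rhoCone_app_vertex_eq_id_iff a).1 h.1.app_vertex⟩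
  exact ⟨_, a.2.2.2, hproj.isGeneratedBy_rhoCone.unique h, hproj⟩

theorem exists_partitionDual_eq [Nonempty X] {F : NormalDual (PartitionCat X)} {a : transSet A π}
    (h : F.IsGeneratedBy (sigmaCone a)) :
    ∃ B, Sub B A ∧ partitionDual B = F ∧ IsProjection a.1 B (sigmaCone a).vertex := by
  have hproj : IsProjection a.1 (imageObj a.1 (range_ne_univ a)) (sigmaCone a).vertex :=
    ⟨rfl, rfl, (sigmaCone_app_vertex_eq_id_iff a).1 h.1.app_vertex⟩
  exact ⟨_, a.2.2.1, hproj.isGeneratedBy_sigmaCone.unique h, hproj⟩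

theorem isProjection_of_isGeneratedBy_rhoCone [Nontrivial X] {a : transSet A π}
    (h : (powersetDual π).IsGeneratedBy (rhoCone a)) :
    IsProjection a.1 (rhoCone a).vertex π := by
  obtain ⟨σ, hσ, heq, hproj⟩ := exists_powersetDual_eq h
  rwa [sub_antisymm hσ (powersetDual_sub_iff.1 (heq ▸ sub_refl _))] at hproj

theorem isProjection_of_isGeneratedBy_sigmaCone [Nonempty X] {a : transSet A π}
    (h : (partitionDual A).IsGeneratedBy (sigmaCone a)) :
    IsProjection a.1 A (sigmaCone a).vertex := by
  obtain ⟨B, hB, heq, hproj⟩ := exists_partitionDual_eq h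
  rwa [sub_antisymm hB ((partitionDual_sub_iff (sub_refl A) hB).1 (heq ▸ sub_refl _))] at hproj

theorem mem_mset_powersetDual_iff [Nontrivial X] :
    A ∈ (powersetDual π).mset ↔ ∃ e, IsProjection e A π := by
  rw [NormalDual.mem_mset_iff]
  constructor
  · rintro ⟨ε, hε, rfl⟩
    obtain ⟨a, ha⟩ := hε.mem
    rw [← ha] at hε ⊢
    exact ⟨a.1, isProjection_of_isGeneratedBy_rhoCone hε⟩
  · rintro ⟨e, he⟩
    exact ⟨rhoCone ⟨e, he.mem⟩, he.isGeneratedBy_rhoCone, he.vertex_rhoCone⟩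

theorem mem_mset_partitionDual_iff [Nonempty X] :
    π ∈ (partitionDual A).mset ↔ ∃ e, IsProjection e A π := by
  rw [NormalDual.mem_mset_iff]
  constructor
  · rintro ⟨ε, hε, rfl⟩
    obtain ⟨a, ha⟩ := hε.mem
    rw [← ha] at hε ⊢
    exact ⟨a.1, isProjection_of_isGeneratedBy_sigmaCone hε⟩
  · rintro ⟨e, he⟩
    exact ⟨sigmaCone ⟨e, he.mem⟩, he.isGeneratedBy_sigmaCone, he.vertex_sigmaCone⟩

end Generators

theorem toPowersetDual_app [Nontrivial X] {A : PowersetCat X} {π π' : PartitionCat X}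
    (u : π ⟶ π') (a : transSet A π) :
    NormalDual.app ((toPowersetDual X).map u) (rhoEquiv A π a) =
      rhoEquiv A π' (transMap (𝟙 A) u a) :=
  congrArg (fun b => rhoEquiv A π' (transMap (𝟙 A) u b)) ((rhoEquiv A π).symm_apply_apply a)

theorem toPartitionDual_app {A B : PowersetCat X} {π : PartitionCat X} (f : A ⟶ B)
    (a : transSet A π) :
    NormalDual.app ((toPartitionDual X).map f) (sigmaEquiv A π a) =
      sigmaEquiv B π (transMap f (𝟙 π) a) :=
  congrArg (fun b => sigmaEquiv B π (transMap f (𝟙 π) b)) ((sigmaEquiv A π).symm_apply_apply a)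

theorem isLocalIso_toPowersetDual [Nontrivial X] : IsLocalIso (toPowersetDual X) := by
  refine .of_map_bijective (fun h => ⟨powersetDual_sub_iff.2 h, ?_⟩) (fun π π' => ?_)
    (fun _ _ => powersetDual_sub_iff.1) fun {π F} hF => ?_
  · refine NormalDual.hom_ext fun A x => ?_
    obtain ⟨a, rfl⟩ := (rhoEquiv A _).surjective x
    exact (toPowersetDual_app _ a).trans (Subtype.ext rfl)
  · obtain ⟨e, A, he, -⟩ := π.exists_isProjection (Classical.arbitrary X)
    refine NormalDual.map_bijective_of_isGeneratedBy (x₀ := rhoEquiv A π ⟨e, he.mem⟩)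
      he.isGeneratedBy_rhoCone ?_
    simp only [toPowersetDual_app]
    exact (rhoEquiv A π').bijective.comp (he.transMap_right_bijective π')
  · obtain ⟨ε, hε⟩ : ∃ ε, F.IsGeneratedBy ε := F.exists_cone
    obtain ⟨a, ha⟩ := hF _ hε.mem
    rw [← ha] at hε
    obtain ⟨σ, hσ, heq, -⟩ := exists_powersetDual_eq hε
    exact ⟨σ, hσ, heq⟩

theorem isLocalIso_toPartitionDual [Nonempty X] : IsLocalIso (toPartitionDual X) := by
  refine .of_map_bijective (fun {A B} h => ⟨(partitionDual_sub_iff h (sub_refl B)).2 h, ?_⟩)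
    (fun A B => ?_) (fun hA hB => (partitionDual_sub_iff hA hB).1) fun {A F} hF => ?_
  · refine NormalDual.hom_ext fun π x => ?_
    obtain ⟨a, rfl⟩ := (sigmaEquiv _ π).surjective x
    exact (toPartitionDual_app _ a).trans (Subtype.ext rfl)
  · obtain ⟨e, π, he⟩ := A.exists_isProjection
    refine NormalDual.map_bijective_of_isGeneratedBy (x₀ := sigmaEquiv A π ⟨e, he.mem⟩)
      he.isGeneratedBy_sigmaCone ?_
    simp only [toPartitionDual_app]
    exact (sigmaEquiv B π).bijective.comp (he.transMap_left_bijective B)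
  · obtain ⟨ε, hε⟩ : ∃ ε, F.IsGeneratedBy ε := F.exists_cone
    obtain ⟨a, ha⟩ := hF _ hε.mem
    rw [← ha] at hε
    obtain ⟨B, hB, heq, -⟩ := exists_partitionDual_eq hε
    exact ⟨B, hB, heq⟩

theorem comap_le_comap_iff {Y Z : Type*} {f : Y → Z} (hf : Function.Surjective f)
    {r s : Setoid Z} : Setoid.comap f r ≤ Setoid.comap f s ↔ r ≤ s := by
  refine ⟨fun h x y hxy => ?_, fun h _ _ hxy => h hxy⟩
  obtain ⟨x, rfl⟩ := hf x
  obtain ⟨y, rfl⟩ := hf y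
  exact h hxy

section Perm

variable (θ : Equiv.Perm X) {A B : PowersetCat X} {π π' : PartitionCat X}

theorem preimagePartition_sub_iff :
    Sub (preimagePartition θ π) (preimagePartition θ π') ↔ Sub π π' :=
  comap_le_comap_iff θ.surjective

theorem powersetPerm_obj_symm (B : PowersetCat X) :
    (powersetPerm θ).obj ((powersetPerm θ.symm).obj B) = B :=
  PowersetCat.ext (θ.image_symm_image B.set)

theorem preimagePartition_symm (π : PartitionCat X) :
    preimagePartition θ (preimagePartition θ.symm π) = π :=
  PartitionCat.ext <| Setoid.ext fun x y => by
    change π.rel (θ.symm (θ x)) (θ.symm (θ y)) ↔ _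
    rw [θ.symm_apply_apply, θ.symm_apply_apply]

theorem isLocalIso_powersetPerm : IsLocalIso (powersetPerm θ) := by
  have hsub : ∀ {A B : PowersetCat X}, Sub ((powersetPerm θ).obj A) ((powersetPerm θ).obj B) →
      Sub A B := (Set.image_subset_image_iff θ.injective).1
  refine .of_map_bijective
    (fun h => ⟨Set.image_mono h, funext fun y => Subtype.ext (θ.apply_symm_apply _)⟩)
    (fun A B => (Equiv.arrowCongr (θ.image A.set) (θ.image B.set)).bijective)
    (fun _ _ => hsub) fun {A B} hB => ⟨(powersetPerm θ.symm).obj B, hsub ?_, ?_⟩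
  · rwa [powersetPerm_obj_symm]
  · exact powersetPerm_obj_symm θ B

theorem isLocalIso_partitionPerm : IsLocalIso (partitionPerm θ) := by
  refine .of_map_bijective
    (fun h => ⟨(preimagePartition_sub_iff θ).2 h, funext fun q => Quotient.inductionOn q fun x =>
      congrArg (Quotient.mk _) (θ.symm_apply_apply x)⟩)
    (fun π π' => (Equiv.arrowCongr (blockEquiv θ π').symm (blockEquiv θ π).symm).bijective)
    (fun _ _ => (preimagePartition_sub_iff θ).1)
    fun {π σ} hσ => ⟨preimagePartition θ.symm σ, (preimagePartition_sub_iff θ).1 ?_, ?_⟩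
  · rwa [preimagePartition_symm]
  · exact preimagePartition_symm θ σ

theorem range_conj (e : X → X) : Set.range (θ.conj e) = θ '' Set.range e :=
  (Set.range_comp θ (e ∘ θ.symm)).trans (congrArg (θ '' ·) (θ.symm.surjective.range_comp e))

theorem comap_ker_conj (e : X → X) : Setoid.comap θ (Setoid.ker (θ.conj e)) = Setoid.ker e :=
  Setoid.ext fun x y => by
    change θ (e (θ.symm (θ x))) = θ (e (θ.symm (θ y))) ↔ e x = e y
    rw [θ.injective.eq_iff, θ.symm_apply_apply, θ.symm_apply_apply]

theorem mem_transSet_iff {a : X → X} :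
    a ∈ transSet A π ↔ Set.range a ⊆ A.set ∧ π.rel ≤ Setoid.ker a :=
  ⟨And.right, fun h => mem_transSet (Set.range_subset_iff.1 h.1) h.2⟩

theorem conj_mem_transSet_iff {a : X → X} :
    θ.conj a ∈ transSet ((powersetPerm θ).obj A) π ↔ a ∈ transSet A (preimagePartition θ π) := by
  rw [mem_transSet_iff, mem_transSet_iff, range_conj, ← comap_ker_conj θ a]
  exact and_congr (Set.image_subset_image_iff θ.injective) (comap_le_comap_iff θ.surjective).symm

theorem isProjection_conj_iff {e : X → X} :
    IsProjection (θ.conj e) ((powersetPerm θ).obj A) π ↔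
      IsProjection e A (preimagePartition θ π) := by
  have hrange : Set.range (θ.conj e) = θ '' A.set ↔ Set.range e = A.set := by
    rw [range_conj, θ.injective.image_injective.eq_iff]
  have hker : Setoid.ker (θ.conj e) = π.rel ↔ Setoid.ker e = Setoid.comap θ π.rel := by
    rw [← comap_ker_conj θ e, (Setoid.comap_injective θ θ.surjective).eq_iff]
  have hidem : (∀ x, θ.conj e (θ.conj e x) = θ.conj e x) ↔ ∀ x, e (e x) = e x := by
    rw [θ.surjective.forall]
    simp only [Equiv.conj_apply, Equiv.symm_apply_apply, θ.injective.eq_iff]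
  exact ⟨fun h => ⟨hrange.1 h.range_eq, hker.1 h.ker_eq, hidem.1 h.idem⟩,
    fun h => ⟨hrange.2 h.range_eq, hker.2 h.ker_eq, hidem.2 h.idem⟩⟩

/-- The bijection `a ↦ θ⁻¹ a θ` (composition from left to right) between the sets
`{a : Im a ⊆ A, π̄_a ⊆ θ⁻¹(π)}` and `{a : Im a ⊆ θ(A), π̄_a ⊆ π̄}`. -/
def conjEquiv (A : PowersetCat X) (π : PartitionCat X) :
    transSet A (preimagePartition θ π) ≃ transSet ((powersetPerm θ).obj A) π :=
  θ.conj.subtypeEquiv fun _ => (conj_mem_transSet_iff θ).symm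

theorem symm_descend_conjEquiv (a : transSet A (preimagePartition θ π)) (q : Quotient π.rel) :
    θ.symm (descend (conjEquiv θ A π a) q).1 = (descend a ((blockEquiv θ π).symm q)).1 :=
  Quotient.inductionOn q fun _ => θ.symm_apply_apply _

theorem conjEquiv_transMap (f : A ⟶ B) (u : π ⟶ π') (a : transSet A (preimagePartition θ π)) :
    conjEquiv θ B π' (transMap f ((partitionPerm θ).map u) a) =
      transMap ((powersetPerm θ).map f) u (conjEquiv θ A π a) := by
  refine Subtype.ext (funext fun x => ?_)
  have hx : blockEquiv θ π' (Quotient.mk _ (θ.symm x)) = Quotient.mk _ x :=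
    congrArg (Quotient.mk _) (θ.apply_symm_apply x)
  change θ (f (descend a ((blockEquiv θ π).symm
    (u (blockEquiv θ π' (Quotient.mk _ (θ.symm x))))))).1 = θ (f ⟨θ.symm _, _⟩).1
  rw [hx]
  exact congrArg (fun y => θ (f y).1) (Subtype.ext (symm_descend_conjEquiv θ a _).symm)

/-- The natural isomorphism `χ : Γ_θ(-,-) ⟶ Δ_θ(-,-)`, `χ(A,π̄) : a ↦ θ⁻¹ a θ`. -/
def conjIso : gammaBifunctor (partitionPerm θ) ≅ deltaBifunctor (powersetPerm θ) :=
  NatIso.ofComponents (fun P => (conjEquiv θ P.1 P.2).toIso) fun g => by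
    ext a
    exact conjEquiv_transMap θ g.1 g.2 a

variable [Nontrivial X]

theorem mem_mset_gammaPerm_iff :
    A ∈ ((gammaPerm θ).obj π).mset ↔ ∃ e, IsProjection e A (preimagePartition θ π) :=
  mem_mset_powersetDual_iff

theorem mem_mset_deltaPerm_iff :
    π ∈ ((deltaPerm θ).obj A).mset ↔ ∃ e, IsProjection e A (preimagePartition θ π) :=
  mem_mset_partitionDual_iff.trans <| θ.conj.surjective.exists.trans <|
    exists_congr fun _ => isProjection_conj_iff θ

theorem isCrossConnection_gammaPerm : IsCrossConnection (gammaPerm θ) where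
  isLocalIso := (isLocalIso_partitionPerm θ).comp isLocalIso_toPowersetDual
  exists_mem_mset A := by
    obtain ⟨e, π, he⟩ := A.exists_isProjection
    rw [← preimagePartition_symm θ π] at he
    exact ⟨_, (mem_mset_gammaPerm_iff θ).2 ⟨e, he⟩⟩

theorem isCrossConnection_deltaPerm : IsCrossConnection (deltaPerm θ) where
  isLocalIso := (isLocalIso_powersetPerm θ).comp isLocalIso_toPartitionDual
  exists_mem_mset π := by
    obtain ⟨e, A, he, -⟩ := (preimagePartition θ π).exists_isProjection (Classical.arbitrary X)
    exact ⟨A, (mem_mset_deltaPerm_iff θ).2 ⟨e, he⟩⟩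

/-- The duality `ρ^a ↦ σ^{θ⁻¹ a θ}` between `Γ_θ` and `Δ_θ`, as functors to the normal duals. -/
noncomputable def permDuality : bifunctorLeft (gammaPerm θ) ≅ bifunctorRight (deltaPerm θ) :=
  (gammaCone (partitionPerm θ)).symm ≪≫ conjIso θ ≪≫ deltaCone (powersetPerm θ)

theorem coneRight_permDuality (a : transSet A (preimagePartition θ π)) :
    coneRight ((permDuality θ).hom.app (A, π) (rhoEquiv A (preimagePartition θ π) a)) =
      sigmaCone (conjEquiv θ A π a) :=
  congrArg (fun b => sigmaCone (conjEquiv θ A π b)) ((rhoEquiv A _).symm_apply_apply a)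

theorem isDuality_permDuality : IsDuality (gammaPerm θ) (deltaPerm θ) (permDuality θ) where
  left := isCrossConnection_gammaPerm θ
  right := isCrossConnection_deltaPerm θ
  mem_mset_iff _ _ := (mem_mset_gammaPerm_iff θ).trans (mem_mset_deltaPerm_iff θ).symm
  map_idempotent A π x hvertex hgen := by
    obtain ⟨a, rfl⟩ := (rhoEquiv A (preimagePartition θ π)).surjective x
    have hproj : IsProjection a.1 (rhoCone a).vertex (preimagePartition θ π) :=
      isProjection_of_isGeneratedBy_rhoCone hgen
    rw [show (rhoCone a).vertex = A from hvertex] at hproj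
    have hconj : IsProjection (conjEquiv θ A π a).1 ((powersetPerm θ).obj A) π :=
      (isProjection_conj_iff θ).2 hproj
    rw [coneRight_permDuality]
    exact ⟨hconj.vertex_sigmaCone, hconj.isGeneratedBy_sigmaCone⟩

end Perm

section Rigidity

/-- The map on points induced by the component of `γ` at `β`: it sends `z` to the block of `β` that
`γ` assigns to the block of `z` in its vertex. -/
def blockMap (γ : SubCone (PartitionCat X)) (β : PartitionCat X) (z : X) : Quotient β.rel :=
  γ.app β (Quotient.mk γ.vertex.rel z)

theorem ext_of_blockMap_eq {γ δ : SubCone (PartitionCat X)} (hvertex : γ.vertex = δ.vertex)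
    (h : ∀ β z, blockMap γ β z = blockMap δ β z) : γ = δ := by
  obtain ⟨v, t, ht⟩ := γ
  obtain ⟨w, t', ht'⟩ := δ
  obtain rfl : v = w := hvertex
  obtain rfl : t = t' := funext fun β => funext fun q => Quotient.inductionOn q (h β)
  rfl

theorem blockMap_of_isIdempotentNormal {γ : SubCone (PartitionCat X)} {β : PartitionCat X}
    (hγ : γ.IsIdempotentNormal) (hvertex : γ.vertex = β) (z : X) :
    blockMap γ β z = Quotient.mk β.rel z := by
  subst hvertex
  exact congrFun hγ.app_vertex _

theorem blockMap_map {F : NormalDual (PartitionCat X)} {π π' : PartitionCat X} {u : π ⟶ π'}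
    {z w : X} (h : u (Quotient.mk π'.rel z) = Quotient.mk π.rel w) (x : F.sets π)
    (β : PartitionCat X) : blockMap (F.map u x).1 β z = blockMap x.1 β w := by
  have hepi : epi (incl (F.sub_of_mem x.2) ≫ u) (Quotient.mk _ z) =
      PartitionCat.coarsen (F.sub_of_mem x.2) (u (Quotient.mk _ z)) :=
    congrFun (epi_incl (incl (F.sub_of_mem x.2) ≫ u)) (Quotient.mk _ z)
  rw [h] at hepi
  exact congrArg (x.1.app β) hepi

/-- The partition of `X` with only one block, along which every constant map factors. -/
def PartitionCat.oneBlock (X : Type u) [Nontrivial X] : PartitionCat X where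
  rel := ⊤
  ne_bot h := by
    obtain ⟨x, y, hxy⟩ := exists_pair_ne X
    exact hxy (h.le (trivial : (⊤ : Setoid X) x y))

variable {θ : Equiv.Perm X} {Δ : PowersetCat X ⥤ NormalDual (PartitionCat X)}
  {A B : PowersetCat X} {π π' : PartitionCat X}

theorem PreservesGenerators.bifunctorApp_sigmaEquiv
    {ψ : bifunctorRight (deltaPerm θ) ⟶ bifunctorRight Δ} (hψ : PreservesGenerators ψ)
    {a : transSet ((powersetPerm θ).obj A) π} (ha : IsProjection a.1 ((powersetPerm θ).obj A) π) :
    (bifunctorApp (c := A) ψ (sigmaEquiv _ π a)).1.vertex = π ∧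
      (Δ.obj A).IsGeneratedBy (bifunctorApp (c := A) ψ (sigmaEquiv _ π a)).1 :=
  hψ A π (sigmaEquiv _ π a) ha.vertex_sigmaCone ha.isGeneratedBy_sigmaCone

variable [Nontrivial X]

/-- The constant map with value `θ p`, regarded as a map into `θ({p})`. -/
def constMap (θ : Equiv.Perm X) (p : X) :
    transSet ((powersetPerm θ).obj (PowersetCat.singleton p)) (PartitionCat.oneBlock X) :=
  ⟨fun _ => θ p, mem_transSet (fun _ => ⟨p, rfl, rfl⟩) fun {_ _} _ => rfl⟩

/-- Precomposition of `a` with a constant map onto the block of `z` yields the constant map with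
value `a z`, up to extension of its codomain. -/
theorem blockMap_bifunctorApp_constMap (ψ : bifunctorRight (deltaPerm θ) ⟶ bifunctorRight Δ)
    (hΔ : IsLocalIso Δ) (a : transSet ((powersetPerm θ).obj A) π) {z p : X} (h : a.1 z = θ p)
    (β : PartitionCat X) (w : X) :
    blockMap (bifunctorApp (c := A) ψ (sigmaEquiv _ π a)).1 β z =
      blockMap (bifunctorApp (c := .singleton p) ψ (sigmaEquiv _ _ (constMap θ p))).1 β w := by
  let u : π ⟶ .oneBlock X := fun _ => Quotient.mk _ z
  have hsub : Sub (.singleton p) A := by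
    rintro _ rfl
    exact (θ.injective.mem_set_image).1 (h ▸ a.2.2.1 ⟨z, rfl⟩)
  have hconst : sigmaCone (constMap θ p) =
      ((partitionDual _).map u (sigmaEquiv ((powersetPerm θ).obj A) π a)).1 := by
    have htrans : (constMap θ p).1 = (transMap (𝟙 _) u a).1 := funext fun _ => h.symm
    rw [partitionDual_map_sigmaEquiv]
    change sigma _ _ = sigma _ _
    simp only [htrans]
  calc blockMap (bifunctorApp (c := A) ψ (sigmaEquiv _ π a)).1 β z
      = blockMap ((Δ.obj A).map u (bifunctorApp (c := A) ψ (sigmaEquiv _ π a))).1 β w :=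
        (blockMap_map (by rfl) _ β).symm
    _ = blockMap (bifunctorApp (c := A) ψ ((partitionDual _).map u (sigmaEquiv _ π a))).1 β w :=
        congrArg (fun x => blockMap (Subtype.val x) β w) (bifunctorApp_map ψ u _).symm
    _ = _ := congrArg (blockMap · β w) (bifunctorApp_val_eq_of_sub ψ
        (isCrossConnection_deltaPerm θ).isLocalIso hΔ hsub hconst).symm

theorem blockMap_bifunctorApp_congr (ψ : bifunctorRight (deltaPerm θ) ⟶ bifunctorRight Δ)
    (hΔ : IsLocalIso Δ) {a : transSet ((powersetPerm θ).obj A) π}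
    {b : transSet ((powersetPerm θ).obj B) π'} {z w : X} (h : a.1 z = b.1 w)
    (β : PartitionCat X) :
    blockMap (bifunctorApp (c := A) ψ (sigmaEquiv _ π a)).1 β z =
      blockMap (bifunctorApp (c := B) ψ (sigmaEquiv _ π' b)).1 β w := by
  obtain ⟨p, hp⟩ := θ.surjective (a.1 z)
  rw [blockMap_bifunctorApp_constMap ψ hΔ a hp.symm β z,
    blockMap_bifunctorApp_constMap ψ hΔ b (h.symm.trans hp.symm) β z]

/-- The value at `β` is read off a projection along `β` that fixes the point `a z`. -/
theorem blockMap_bifunctorApp {ψ : bifunctorRight (deltaPerm θ) ⟶ bifunctorRight Δ}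
    (hΔ : IsLocalIso Δ) (hψ : PreservesGenerators ψ) (a : transSet ((powersetPerm θ).obj A) π)
    (β : PartitionCat X) (z : X) :
    blockMap (bifunctorApp (c := A) ψ (sigmaEquiv _ π a)).1 β z = Quotient.mk β.rel (a.1 z) := by
  obtain ⟨f, B, hf, hz⟩ := β.exists_isProjection (a.1 z)
  rw [← powersetPerm_obj_symm θ B] at hf hz
  obtain ⟨hvertex, hgen⟩ := hψ.bifunctorApp_sigmaEquiv (a := ⟨f, hf.mem⟩) hf
  rw [blockMap_bifunctorApp_congr ψ hΔ (b := ⟨f, hf.mem⟩) (hf.apply_of_mem hz).symm]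
  exact blockMap_of_isIdempotentNormal hgen.1 hvertex _

theorem bifunctorApp_val_eq {ψ : bifunctorRight (deltaPerm θ) ⟶ bifunctorRight Δ}
    (hΔ : IsLocalIso Δ) (hψ : PreservesGenerators ψ) (x : ((deltaPerm θ).obj A).sets π) :
    (bifunctorApp ψ x).1 = x.1 := by
  obtain ⟨e, σ, he⟩ := ((powersetPerm θ).obj A).exists_isProjection
  let a : transSet ((powersetPerm θ).obj A) σ := ⟨e, he.mem⟩
  refine bifunctorApp_val_eq_of_isGeneratedBy (x₀ := sigmaEquiv _ σ a)
    (IsProjection.isGeneratedBy_sigmaCone (a := a) he) (ext_of_blockMap_eq ?_ fun β z => ?_) x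
  · exact (hψ.bifunctorApp_sigmaEquiv (a := a) he).1.trans
      (IsProjection.vertex_sigmaCone (a := a) he).symm
  · exact blockMap_bifunctorApp hΔ hψ a β z

variable {χ : bifunctorLeft (gammaPerm θ) ≅ bifunctorRight Δ}

theorem IsDuality.bifunctorApp_val_eq (h : IsDuality (gammaPerm θ) Δ χ)
    (x : ((deltaPerm θ).obj A).sets π) :
    (bifunctorApp ((permDuality θ).symm ≪≫ χ).hom x).1 = x.1 :=
  CrossConn.bifunctorApp_val_eq h.right.isLocalIso
    ((isDuality_permDuality θ).preservesGenerators h) x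

theorem IsDuality.eq_deltaPerm (h : IsDuality (gammaPerm θ) Δ χ) : Δ = deltaPerm θ :=
  (functor_eq_of_bifunctorApp_val_eq ((permDuality θ).symm ≪≫ χ)
    fun _ _ => h.bifunctorApp_val_eq).symm

theorem IsDuality.eq_permDuality {χ : bifunctorLeft (gammaPerm θ) ≅ bifunctorRight (deltaPerm θ)}
    (h : IsDuality (gammaPerm θ) (deltaPerm θ) χ) : χ = permDuality θ := by
  have hid : (permDuality θ).symm ≪≫ χ = Iso.refl _ := by
    ext P x
    exact Subtype.ext (h.bifunctorApp_val_eq x)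
  exact ((Iso.symm_self_id_assoc _ _).symm.trans (congrArg (permDuality θ ≪≫ ·) hid)).trans
    (Iso.trans_refl _)

end Rigidity

end CrossConn

theorem mainTheorem5 {X : Type u} [Nontrivial X] (θ : Equiv.Perm X) :
    ∃ χ : gammaBifunctor (partitionPerm θ) ≅ deltaBifunctor (powersetPerm θ),
      (∀ (A : PowersetCat X) (π : PartitionCat X)
        (a : (gammaBifunctor (partitionPerm θ)).obj (A, π)),
        deltaTrans (χ.hom.app (A, π) a) = fun x => θ (gammaTrans a (θ.symm x))) ∧
      IsDuality (gammaPerm θ) (deltaPerm θ)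
        ((gammaCone (partitionPerm θ)).symm ≪≫ χ ≪≫ deltaCone (powersetPerm θ)) ∧
      (∀ χ' : bifunctorLeft (gammaPerm θ) ≅ bifunctorRight (deltaPerm θ),
        IsDuality (gammaPerm θ) (deltaPerm θ) χ' →
          χ' = (gammaCone (partitionPerm θ)).symm ≪≫ χ ≪≫ deltaCone (powersetPerm θ)) ∧
      (∀ (Δ : PowersetCat X ⥤ NormalDual (PartitionCat X))
        (χ' : bifunctorLeft (gammaPerm θ) ≅ bifunctorRight Δ),
        IsDuality (gammaPerm θ) Δ χ' → Δ = deltaPerm θ) :=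
  ⟨conjIso θ, fun _ _ _ => rfl, isDuality_permDuality θ, fun _ h => h.eq_permDuality,
    fun _ _ h => h.eq_deltaPerm⟩
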